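/- Let $A_e>0$ and let $A_2,h_0\in\mathbb R$ be arbitrary. The equation $$t\,h_t\bigl((t\,h_t)^2-h(t)^2+A_2\bigr)-A_e\,(t+t^{-1})=0\qquad(\ast)$$ has a solution $h:(0,\infty)\to\mathbb R$ with $h(1)=h_0$ and $h_t(1)>0$, and every solution with these initial conditions on an open interval $J\subseteq(0,\infty)$ containing $1$ is the restriction of $h$ to $J$. For this $h$ the following hold. 1. The metric $$g=\frac{dt^2+t^2\,d\varphi^2}{t^4h_t^2},$$ given in polar coordinates $(t,\varphi)$ on $\mathbb R^2\setminus\{0\}$, extends to a real-analytic Riemannian metric $g$ on the sphere $S^2=\overline{\mathbb C}=\mathbb R^2\cup\{\infty\}$ (with the real-analytic structure given by the coordinates $z$ on $\mathbb R^2$ and $z/|z|^2$ near $\infty$). 2. The vector field $\partial/\partial\varphi$ extends to a real-analytic vector field on $S^2$ that is Killing for $g$. The corresponding function $L=p_\varphi$ on $T^*S^2$ is linear in momenta with real-analytic coefficients and is an integral of the geodesic flow of $g$, i.e. $\{L,H\}=0$, where $H=\frac12 g^{ij}p_ip_j$. 3. Put $x=\log t$, $y=\varphi$, and regard $h$ as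 a function of $x$. For all real constants $C_e,\phi_0$ the function $$F=C_e\cos(y+\phi_0)\bigl(a_0p_x^3+a_2p_xp_y^2\bigr)+C_e\sin(y+\phi_0)\bigl(a_1p_x^2p_y+a_3p_y^3\bigr),$$ $$a_0=h_x^3,\quad a_1=h\,h_x^2,\quad a_2=\tfrac12(3h_x^2-h^2+A_2)h_x,\quad a_3=\tfrac12(3h_x^2-h^2+A_2)h_{xx},$$ extends to a function on $T^*S^2$ which is a homogeneous cubic polynomial in momenta with real-analytic coefficients and which is an integral of the geodesic flow of $g$, i.e. $\{F,H\}=0$. If $C_e\neq0$, then $L$, $F$ and $H$ are functionally independent (their differentials are linearly independent at some point of $T^*S^2$). 4. The metric $g$ has constant Gaussian curvature if and only if $h_0=0$. In particular, for $h_0\neq0$ the metric $g$ on $S^2$ has non-constant curvature and is superintegrable, with one linear and one cubic integral. -/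

import Mathlib

open scoped Manifold ContDiff

-- `TopCat` instances that would otherwise be found instead of `chartedSpaceSelf`.
attribute [-instance] TopCat.of.chartedSpace TopCat.of.hasGroupoid

noncomputable section

namespace AnalyticSphere

/-! ### The sphere as the plane with a point at infinity -/

/-- The Euclidean plane `ℝ²`. -/
abbrev Plane : Type := EuclideanSpace ℝ (Fin 2)

/-- The sphere `S² = ℝ² ∪ {∞}`. -/
abbrev S2 : Type := OnePoint Plane

/-- Inversion `z ↦ z / |z|²` in the unit circle, exchanging `0` and `∞`. -/
def invFun : S2 → S2
  | OnePoint.infty => ((0 : Plane) : S2)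
  | OnePoint.some z => open Classical in
      if z = 0 then OnePoint.infty else ((EuclideanGeometry.inversion (0 : Plane) 1 z : Plane) : S2)

@[simp] lemma invFun_infty : invFun OnePoint.infty = ((0 : Plane) : S2) := rfl

@[simp] lemma invFun_zero : invFun ((0 : Plane) : S2) = OnePoint.infty := by
  change (if (0 : Plane) = 0 then _ else _) = _
  simp

lemma invFun_coe {z : Plane} (hz : z ≠ 0) :
    invFun (z : S2) = ((EuclideanGeometry.inversion (0 : Plane) 1 z : Plane) : S2) := by
  change (if z = 0 then _ else _) = _
  simp [hz]

lemma inversion_ne_zero {z : Plane} (hz : z ≠ 0) :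
    EuclideanGeometry.inversion (0 : Plane) 1 z ≠ 0 := by
  rw [Ne, EuclideanGeometry.inversion_eq_center one_ne_zero]
  exact hz

lemma invFun_invFun (p : S2) : invFun (invFun p) = p := by
  induction p using OnePoint.rec with
  | infty => simp
  | coe z =>
    by_cases hz : z = 0
    · subst hz; simp
    · rw [invFun_coe hz, invFun_coe (inversion_ne_zero hz),
        EuclideanGeometry.inversion_inversion _ one_ne_zero]

lemma continuousAt_inversion {z : Plane} (hz : z ≠ 0) :
    ContinuousAt (EuclideanGeometry.inversion (0 : Plane) 1) z :=
  (ContDiffAt.inversion (n := 0) contDiffAt_const contDiffAt_const contDiffAt_id hz).continuousAt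

lemma norm_inversion (z : Plane) :
    ‖EuclideanGeometry.inversion (0 : Plane) 1 z‖ = ‖z‖⁻¹ := by
  have := EuclideanGeometry.dist_inversion_center (0 : Plane) z 1
  simpa using this

lemma continuous_invFun : Continuous invFun := by
  rw [continuous_iff_continuousAt]
  intro p
  induction p using OnePoint.rec with
  | infty =>
    rw [OnePoint.continuousAt_infty', invFun_infty, Filter.coclosedCompact_eq_cocompact]
    have h1 : Filter.Tendsto (EuclideanGeometry.inversion (0 : Plane) 1)
        (Filter.cocompact Plane) (nhds 0) := by
      rw [tendsto_zero_iff_norm_tendsto_zero]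
      simp only [norm_inversion]
      exact tendsto_inv_atTop_zero.comp (tendsto_norm_cocompact_atTop (E := Plane))
    have h2 := (OnePoint.continuous_coe (X := Plane)).continuousAt.tendsto.comp h1
    refine h2.congr' ?_
    have h3 : ∀ᶠ z : Plane in Filter.cocompact Plane, z ≠ 0 :=
      (Bornology.IsBounded.isCompact_closure
        (Bornology.isBounded_singleton (x := (0 : Plane)))).compl_mem_cocompact |>
        Filter.mem_of_superset <| fun z hz h => hz (subset_closure h)
    filter_upwards [h3] with z hz
    simp [invFun_coe hz]
  | coe z =>
    rw [OnePoint.continuousAt_coe]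
    by_cases hz : z = 0
    · subst hz
      rw [ContinuousAt, Function.comp_apply, invFun_zero, ← nhdsNE_sup_pure,
        Filter.tendsto_sup]
      refine ⟨?_, ?_⟩
      · have h1 : Filter.Tendsto (EuclideanGeometry.inversion (0 : Plane) 1)
            (nhdsWithin 0 {0}ᶜ) (Filter.coclosedCompact Plane) := by
          rw [Filter.coclosedCompact_eq_cocompact, ← Metric.cobounded_eq_cocompact]
          exact EuclideanGeometry.tendsto_inversion_nhdsNE_center_cobounded one_ne_zero
        refine (OnePoint.tendsto_coe_infty.comp h1).congr' ?_
        filter_upwards [self_mem_nhdsWithin] with z hz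
        simp [invFun_coe hz]
      · rw [Filter.tendsto_pure_left]
        intro s hs
        simpa using mem_of_mem_nhds hs
    · have h2 := (OnePoint.continuous_coe (X := Plane)).continuousAt.comp
        (continuousAt_inversion hz)
      refine h2.congr ?_
      filter_upwards [isOpen_ne.mem_nhds hz] with w hw
      simp [invFun_coe hw]

/-- Inversion as a homeomorphism of the sphere. -/
def invHomeo : S2 ≃ₜ S2 where
  toFun := invFun
  invFun := invFun
  left_inv := invFun_invFun
  right_inv := invFun_invFun
  continuous_toFun := continuous_invFun
  continuous_invFun := continuous_invFun

/-- The standard coordinate on `S² ∖ {∞} = ℝ²`. -/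
def chartZero : OpenPartialHomeomorph S2 Plane :=
  (OnePoint.isOpenEmbedding_coe.toOpenPartialHomeomorph ((↑) : Plane → S2)).symm

/-- The coordinate `z / |z|²` on `S² ∖ {0}`, vanishing at `∞`. -/
def chartInfty : OpenPartialHomeomorph S2 Plane :=
  invHomeo.toOpenPartialHomeomorph.trans chartZero

lemma chartZero_source : chartZero.source = Set.range ((↑) : Plane → S2) := by
  simp [chartZero]

lemma chartZero_target : chartZero.target = Set.univ := by
  simp [chartZero]

lemma chartZero_symm_apply (z : Plane) : chartZero.symm z = (z : S2) := by
  simp [chartZero]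

lemma chartZero_coe (z : Plane) : chartZero (z : S2) = z := by
  have := chartZero.right_inv (x := z) (by simp [chartZero_target])
  rwa [chartZero_symm_apply] at this

lemma chartInfty_apply (p : S2) : chartInfty p = chartZero (invFun p) := rfl

lemma chartInfty_symm_apply (z : Plane) : chartInfty.symm z = invFun (z : S2) := by
  simp only [chartInfty, OpenPartialHomeomorph.coe_trans_symm, Function.comp_apply,
    chartZero_symm_apply]
  rfl

lemma chartInfty_source : chartInfty.source = invFun ⁻¹' Set.range ((↑) : Plane → S2) := by
  simp only [chartInfty, OpenPartialHomeomorph.trans_source, chartZero_source]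
  simp
  rfl

/-- The two coordinates make `S² = ℝ² ∪ {∞}` a surface. -/
instance : ChartedSpace Plane S2 where
  atlas := {chartZero, chartInfty}
  chartAt := fun p => match p with
    | OnePoint.infty => chartInfty
    | OnePoint.some _ => chartZero
  mem_chart_source := by
    intro p
    induction p using OnePoint.rec with
    | infty =>
      change OnePoint.infty ∈ chartInfty.source
      rw [chartInfty_source]
      exact ⟨0, rfl⟩
    | coe z =>
      change (z : S2) ∈ chartZero.source
      rw [chartZero_source]
      exact ⟨z, rfl⟩
  chart_mem_atlas := by
    intro p
    induction p using OnePoint.rec with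
    | infty => exact Or.inr rfl
    | coe z => exact Or.inl rfl

lemma contDiffOn_inversion :
    ContDiffOn ℝ ω (EuclideanGeometry.inversion (0 : Plane) 1) {0}ᶜ := by
  have h : ContDiffOn ℝ ω (fun z : Plane => (‖z‖ ^ 2)⁻¹ • z) {0}ᶜ :=
    ((contDiff_norm_sq ℝ).contDiffOn.inv fun z hz => by simpa using hz).smul contDiffOn_id
  refine h.congr fun z _ => ?_
  simp [EuclideanGeometry.inversion]

/-- The change of coordinates `z ↦ z / |z|²` is real-analytic off the origin. -/
instance : IsManifold (𝓡 2) ω S2 := by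
  have key : ∀ z : Plane, invFun (z : S2) ∈ Set.range ((↑) : Plane → S2) → z ≠ 0 := by
    rintro z hz rfl
    simp at hz
  refine isManifold_of_contDiffOn (𝓡 2) ω S2 ?_
  intro e e' he he'
  have he : e = chartZero ∨ e = chartInfty := he
  have he' : e' = chartZero ∨ e' = chartInfty := he'
  simp only [modelWithCornersSelf_coe, modelWithCornersSelf_coe_symm, Function.comp_id,
    Function.id_comp, Set.preimage_id, Set.range_id, Set.inter_univ,
    OpenPartialHomeomorph.coe_trans]
  rcases he with rfl | rfl <;> rcases he' with rfl | rfl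
  · refine contDiffOn_id.congr fun z _ => ?_
    simp [chartZero_symm_apply, chartZero_coe]
  · have hs : (chartZero.symm.trans chartInfty).source ⊆ {0}ᶜ := by
      intro z hz
      simp only [OpenPartialHomeomorph.trans_source, Set.mem_inter_iff, Set.mem_preimage,
        chartZero_symm_apply, chartInfty_source] at hz
      exact key z hz.2
    refine (contDiffOn_inversion.mono hs).congr fun z hz => ?_
    simp [chartZero_symm_apply, chartInfty_apply, invFun_coe (hs hz), chartZero_coe]
  · have hs : (chartInfty.symm.trans chartZero).source ⊆ {0}ᶜ := by
      intro z hz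
      simp only [OpenPartialHomeomorph.trans_source, Set.mem_inter_iff, Set.mem_preimage,
        chartInfty_symm_apply, chartZero_source] at hz
      exact key z hz.2
    refine (contDiffOn_inversion.mono hs).congr fun z hz => ?_
    simp [chartInfty_symm_apply, invFun_coe (hs hz), chartZero_coe]
  · refine contDiffOn_id.congr fun z _ => ?_
    simp [chartInfty_symm_apply, chartInfty_apply, invFun_invFun, chartZero_coe]

/-! ### Riemannian metrics, curvature and geodesic flows on surfaces -/

section Surface

variable {M : Type} [TopologicalSpace M] [ChartedSpace Plane M] [IsManifold (𝓡 2) ω M]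

variable (M) in
/-- A real-analytic Riemannian metric on the surface `M`. -/
abbrev AnalyticMetric : Type :=
  Bundle.ContMDiffRiemannianMetric (𝓡 2) ω Plane (fun p : M => TangentSpace (𝓡 2) p)

variable (M) in
/-- A function on the cotangent bundle `T*M`. -/
abbrev PhaseFunction : Type := (p : M) → (TangentSpace (𝓡 2) p →L[ℝ] ℝ) → ℝ

/-- The `i`-th partial derivative of a function on the plane. -/
def partialDeriv (i : Fin 2) (f : Plane → ℝ) (x : Plane) : ℝ :=
  fderiv ℝ f x (EuclideanSpace.single i 1)

/-- The coordinate vector field `∂/∂xᵢ` of the chart `e`, at the point with coordinates `x`. -/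
def coordVector (e : OpenPartialHomeomorph M Plane) (x : Plane) (i : Fin 2) :
    TangentSpace (𝓡 2) (e.symm x) :=
  mfderiv (𝓡 2) (𝓡 2) e.symm x (EuclideanSpace.single i 1 : Plane)

/-- The matrix `gᵢⱼ` of the metric in the chart `e`, as a function of the coordinates. -/
def metricMatrix (G : AnalyticMetric M) (e : OpenPartialHomeomorph M Plane) (x : Plane) :
    Matrix (Fin 2) (Fin 2) ℝ :=
  Matrix.of fun i j => G.inner (e.symm x) (coordVector e x i) (coordVector e x j)

/-- The Christoffel symbols `Γᵏᵢⱼ` of a matrix-valued function `g`. -/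
def christoffel (g : Plane → Matrix (Fin 2) (Fin 2) ℝ) (k i j : Fin 2) (x : Plane) : ℝ :=
  (1 / 2) * ∑ l, (g x)⁻¹ k l *
    (partialDeriv i (fun y => g y j l) x + partialDeriv j (fun y => g y i l) x
      - partialDeriv l (fun y => g y i j) x)

/-- The components `Rˡₖᵢⱼ` of the curvature tensor, `R(∂ᵢ, ∂ⱼ) ∂ₖ = ∑ Rˡₖᵢⱼ ∂ₗ`. -/
def riemannTensor (g : Plane → Matrix (Fin 2) (Fin 2) ℝ) (l k i j : Fin 2) (x : Plane) : ℝ :=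
  partialDeriv i (christoffel g l j k) x - partialDeriv j (christoffel g l i k) x
    + ∑ m, (christoffel g l i m x * christoffel g m j k x
      - christoffel g l j m x * christoffel g m i k x)

/-- The Gaussian curvature `⟨R(∂₀, ∂₁) ∂₁, ∂₀⟩ / det g`. -/
def gaussCurvature (g : Plane → Matrix (Fin 2) (Fin 2) ℝ) (x : Plane) : ℝ :=
  (∑ l, riemannTensor g l 1 0 1 x * g x l 0) / (g x).det

/-- The Gaussian curvature of the metric is the same at all points. -/
def HasConstantCurvature (G : AnalyticMetric M) : Prop :=
  ∃ κ : ℝ, ∀ e ∈ atlas Plane M, ∀ x ∈ e.target, gaussCurvature (metricMatrix G e) x = κ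

/-- The components in the chart `e` of a vector field. -/
def fieldCoord (V : (p : M) → TangentSpace (𝓡 2) p) (e : OpenPartialHomeomorph M Plane)
    (x : Plane) : Plane :=
  mfderiv (𝓡 2) (𝓡 2) e (e.symm x) (V (e.symm x))

/-- The vector field `V` is Killing: the Lie derivative
`∑ₖ (Vᵏ ∂ₖ gᵢⱼ + gₖⱼ ∂ᵢ Vᵏ + gᵢₖ ∂ⱼ Vᵏ)` of the metric along `V` vanishes. -/
def IsKilling (G : AnalyticMetric M) (V : (p : M) → TangentSpace (𝓡 2) p) : Prop :=
  ∀ e ∈ atlas Plane M, ∀ x ∈ e.target, ∀ i j : Fin 2,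
    ∑ k, (fieldCoord V e x k * partialDeriv k (fun y => metricMatrix G e y i j) x
      + metricMatrix G e x k j * partialDeriv i (fun y => fieldCoord V e y k) x
      + metricMatrix G e x i k * partialDeriv j (fun y => fieldCoord V e y k) x) = 0

/-- The covector `ξ₀ dx₀ + ξ₁ dx₁` at the point with coordinates `x` in the chart `e`. -/
def covector (e : OpenPartialHomeomorph M Plane) (x ξ : Plane) :
    TangentSpace (𝓡 2) (e.symm x) →L[ℝ] ℝ :=
  (innerSL ℝ ξ : Plane →L[ℝ] ℝ).comp
    (mfderiv (𝓡 2) (𝓡 2) e (e.symm x) : TangentSpace (𝓡 2) (e.symm x) →L[ℝ] Plane)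

/-- The expression of a function on `T*M` in the coordinates `(x, ξ)` (positions and momenta)
given by the chart `e`. -/
def localExpr (F : PhaseFunction M) (e : OpenPartialHomeomorph M Plane) (q : Plane × Plane) : ℝ :=
  F (e.symm q.1) (covector e q.1 q.2)

/-- The Hamiltonian `H = ½ ∑ gⁱʲ ξᵢ ξⱼ` of the geodesic flow in the chart `e`. -/
def localHamiltonian (G : AnalyticMetric M) (e : OpenPartialHomeomorph M Plane)
    (q : Plane × Plane) : ℝ :=
  (1 / 2) * ∑ i, ∑ j, (metricMatrix G e q.1)⁻¹ i j * q.2 i * q.2 j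

/-- The canonical Poisson bracket `∑ᵢ (∂f/∂xᵢ ∂k/∂ξᵢ - ∂f/∂ξᵢ ∂k/∂xᵢ)`. -/
def poissonBracket (f k : Plane × Plane → ℝ) (q : Plane × Plane) : ℝ :=
  ∑ i : Fin 2,
    (fderiv ℝ f q (EuclideanSpace.single i 1, 0) * fderiv ℝ k q (0, EuclideanSpace.single i 1)
      - fderiv ℝ f q (0, EuclideanSpace.single i 1) * fderiv ℝ k q (EuclideanSpace.single i 1, 0))

/-- `F` is an integral of the geodesic flow of `G`: `{F, H} = 0` on `T*M`. -/
def IsGeodesicIntegral (G : AnalyticMetric M) (F : PhaseFunction M) : Prop :=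
  ∀ e ∈ atlas Plane M, ∀ x ∈ e.target, ∀ ξ : Plane,
    poissonBracket (localExpr F e) (localHamiltonian G e) (x, ξ) = 0

/-- `F` is polynomial in momenta, homogeneous of degree `d`, with real-analytic coefficients:
in local coordinates `F = ∑ᵢ aᵢ(x) ξ₀^(d-i) ξ₁^i`. -/
def IsAnalyticPolynomial (d : ℕ) (F : PhaseFunction M) : Prop :=
  ∀ e ∈ atlas Plane M, ∃ a : Fin (d + 1) → Plane → ℝ,
    (∀ i, AnalyticOnNhd ℝ (a i) e.target) ∧
    ∀ x ∈ e.target, ∀ ξ : Plane,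
      localExpr F e (x, ξ) = ∑ i : Fin (d + 1), a i x * ξ 0 ^ (d - (i : ℕ)) * ξ 1 ^ (i : ℕ)

/-- `L`, `F` and the Hamiltonian `H` of the metric are functionally independent: their
differentials are linearly independent at some point of `T*M`. -/
def FunctionallyIndependent (G : AnalyticMetric M) (L F : PhaseFunction M) : Prop :=
  ∃ e ∈ atlas Plane M, ∃ x ∈ e.target, ∃ ξ : Plane,
    LinearIndependent ℝ ![fderiv ℝ (localExpr L e) (x, ξ), fderiv ℝ (localExpr F e) (x, ξ),
      fderiv ℝ (localHamiltonian G e) (x, ξ)]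

/-- The function `p_V` on `T*M`, linear in momenta, that is given by a vector field `V`. -/
def linearMomentum (V : (p : M) → TangentSpace (𝓡 2) p) : PhaseFunction M :=
  fun p α => α (V p)

end Surface

/-! ### The Principal equation, its metric and its cubic integrals -/

/-- `h` solves `t h_t ((t h_t)² - h² + A₂) - A_e (t + t⁻¹) = 0` on `J`, with `h(1) = h₀` and
`h_t(1) > 0`. -/
def IsPrincipalSolution (Ae A2 h0 : ℝ) (J : Set ℝ) (h : ℝ → ℝ) : Prop :=
  (∀ t ∈ J, DifferentiableAt ℝ h t) ∧
  (∀ t ∈ J, t * deriv h t * ((t * deriv h t) ^ 2 - h t ^ 2 + A2) - Ae * (t + t⁻¹) = 0) ∧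
  h 1 = h0 ∧ 0 < deriv h 1

/-- The point of `ℝ² ⊆ S²` with polar coordinates `(t, φ)`. -/
def polarPoint (u : ℝ × ℝ) : S2 :=
  ((!₂[u.1 * Real.cos u.2, u.1 * Real.sin u.2] : Plane) : S2)

/-- The tangent vector `a ∂/∂t + b ∂/∂φ` at the point with polar coordinates `(t, φ)`. -/
def polarVector (u w : ℝ × ℝ) : TangentSpace (𝓡 2) (polarPoint u) :=
  mfderiv 𝓘(ℝ, ℝ × ℝ) (𝓡 2) polarPoint u w

/-- The metric `G` on `S²` extends `(dt² + t² dφ²) / (t⁴ h_t²)`. -/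
def ExtendsPolarMetric (h : ℝ → ℝ) (G : AnalyticMetric S2) : Prop :=
  ∀ t φ : ℝ, 0 < t → ∀ w w' : ℝ × ℝ,
    G.inner (polarPoint (t, φ)) (polarVector (t, φ) w) (polarVector (t, φ) w')
      = (w.1 * w'.1 + t ^ 2 * (w.2 * w'.2)) / (t ^ 4 * deriv h t ^ 2)

/-- The vector field `V` on `S²` extends `∂/∂φ`. -/
def ExtendsRotation (V : (p : S2) → TangentSpace (𝓡 2) p) : Prop :=
  ∀ t φ : ℝ, 0 < t → V (polarPoint (t, φ)) = polarVector (t, φ) (0, 1)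

/-- The cubic form in the momenta `(px, py)` dual to `(x, y)`,
`C cos(y + φ₀) (a₀ px³ + a₂ px py²) + C sin(y + φ₀) (a₁ px² py + a₃ py³)`, where
`a₀ = k_x³`, `a₁ = k k_x²`, `a₂ = ½ (3 k_x² - k² + A₂) k_x`, `a₃ = ½ (3 k_x² - k² + A₂) k_xx`. -/
def cubicForm (A2 C φ0 : ℝ) (k : ℝ → ℝ) (x y px py : ℝ) : ℝ :=
  let kx := deriv k x
  let kxx := deriv (deriv k) x
  C * Real.cos (y + φ0) *
      (kx ^ 3 * px ^ 3 + (1 / 2) * (3 * kx ^ 2 - k x ^ 2 + A2) * kx * (px * py ^ 2))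
    + C * Real.sin (y + φ0) *
      (k x * kx ^ 2 * (px ^ 2 * py) + (1 / 2) * (3 * kx ^ 2 - k x ^ 2 + A2) * kxx * py ^ 3)

/-- `F` extends the cubic form above from the punctured plane with coordinates `x = log t`,
`y = φ`, for the function `k(x) = h(eˣ)`; here `∂/∂x = t ∂/∂t` and `∂/∂y = ∂/∂φ`. -/
def ExtendsCubicForm (A2 C φ0 : ℝ) (h : ℝ → ℝ) (F : PhaseFunction S2) : Prop :=
  ∀ x y : ℝ, ∀ α : TangentSpace (𝓡 2) (polarPoint (Real.exp x, y)) →L[ℝ] ℝ,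
    F (polarPoint (Real.exp x, y)) α =
      cubicForm A2 C φ0 (fun s => h (Real.exp s)) x y
        (α (polarVector (Real.exp x, y) (Real.exp x, 0)))
        (α (polarVector (Real.exp x, y) (0, 1)))

end AnalyticSphere

end

open AnalyticSphere

open AnalyticSphere

namespace AnalyticSphere

open Filter Topology

/-! ### Fibres of a proper local graph over the half-line -/

/-! With `x = log t` and `s = t ^ 2`, put `u = e^x (h_x - h) / 2` and `v = e^{-x} (h_x + h) / 2`, so
that `h = t v - u / t`, `t h_t = (u + s v) / t` and `h_x² - h² = 4uv`. Writing `D = 4uv + A2`, the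
Principal equation becomes the algebraic relation `(u + s v) D = Ae (1 + s)`, while `h_x = dh/dx`
becomes `u' = s v'`. Together they make `Ae (u + v) - D² / 8` a first integral, since its derivative
is `v' (Ae (1 + s) - D (u + s v))`. The solution is therefore an algebraic curve over the `s`-line,
and its behaviour at `s = 0` is no worse than elsewhere.

Existence: for `h0 ≠ 0` the level set `levelCurve` is proper over `[0, ∞)` (`isCompact_levelCurve`)
and is locally the graph of an analytic function (`levelCurve_local_graph`), because its level
avoids the singular points `u = v` (`isRegularLevel_initial`). The property of having exactly one
point in the fibre is then constant in `s` (`existsUnique_fiber`), and it holds at `s = 1`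
(`existsUnique_initial`). Hence `u` and `v` are analytic on all of `[0, ∞)`, including `0`. For `h0
= 0` they are equal constants. The symmetry `h(x) ↦ -h(-x)`, which is `(s, u, v) ↦ (1/s, v, u)`,
gives data of the same kind at `∞` (`exists_sphereData`). Uniqueness is a Grönwall argument on the
positive root `t h_t` (`IsPrincipalSolution.eqOn`).

Geometry: the metric is `|dx|² / ψ²` with `ψ = u + s v` analytic and positive in each of the two
charts. The cubic form, rewritten in `u`, `v` and Cartesian momenta, is a polynomial without
denominators (`cubicValue_polar`). Inversion exchanges `u` and `v` and replaces `C` by `-C`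
(`cubicValue_inversion`), so it extends over `∞`. Its bracket with the Hamiltonian vanishes by the
equation for `v'` (`RadialData.poissonBracket_cubicIntegral`).

Curvature: at `0` and `∞` it equals `4uv` for the respective data. If the two values agreed, the
data at the two poles would coincide, contradicting the opposite signs of `Ae - v D` there; so the
curvature is not constant when `h0 ≠ 0`. When `u = v = a` it is `4a²`. -/

lemma eventually_fiber_subset {E : Type*} [TopologicalSpace E] {Z U : Set (ℝ × E)}
    (hc : ∀ N : ℝ, IsCompact (Z ∩ {z | z.1 ≤ N})) (hU : IsOpen U) {s : ℝ}
    (hs : ∀ e, (s, e) ∈ Z → (s, e) ∈ U) :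
    ∀ᶠ s' in 𝓝 s, ∀ e, (s', e) ∈ Z → (s', e) ∈ U := by
  -- The parameters at which the fibre leaves `U`, truncated at `s + 1` to have compactness, form a
  -- closed set that misses `s`.
  have hK : IsCompact (Prod.fst '' ((Z ∩ {z | z.1 ≤ s + 1}) \ U)) :=
    ((hc (s + 1)).diff hU).image continuous_fst
  have hmem : s ∉ Prod.fst '' ((Z ∩ {z | z.1 ≤ s + 1}) \ U) := by
    rintro ⟨⟨s', e⟩, ⟨⟨h1, -⟩, h2⟩, rfl⟩
    exact h2 (hs e h1)
  filter_upwards [hK.isClosed.isOpen_compl.mem_nhds hmem, Iio_mem_nhds (lt_add_one s)]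
    with s' h1 h2 e he
  by_contra h3
  exact h1 ⟨(s', e), ⟨⟨he, (show s' ≤ s + 1 from le_of_lt h2)⟩, h3⟩, rfl⟩

lemma eventually_graph_mem {E : Type*} [TopologicalSpace E] {Z : Set (ℝ × E)} {z : ℝ × E}
    {γ : ℝ → E} (hγ : ContinuousAt γ z.1) (hz : γ z.1 = z.2)
    (h : ∀ᶠ z' in 𝓝 z, 0 ≤ z'.1 → (z' ∈ Z ↔ γ z'.1 = z'.2)) :
    ∀ᶠ s in 𝓝[Set.Ici 0] z.1, (s, γ s) ∈ Z := by
  have h1 : Tendsto (fun s => (s, γ s)) (𝓝 z.1) (𝓝 z) := by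
    have := (continuousAt_id.prodMk hγ).tendsto
    simpa [hz] using this
  filter_upwards [nhdsWithin_le_nhds (h1.eventually h), self_mem_nhdsWithin] with s h2 h3
  exact (h2 h3).2 rfl

/-- A proper local homeomorphism to a connected base has a locally constant number of sheets; only
the property of having exactly one is followed here. -/
lemma existsUnique_fiber {E : Type*} [TopologicalSpace E] [T2Space E] {Z : Set (ℝ × E)}
    (hc : ∀ N : ℝ, IsCompact (Z ∩ {z | z.1 ≤ N}))
    (hloc : ∀ z ∈ Z, ∃ γ : ℝ → E, ContinuousAt γ z.1 ∧ γ z.1 = z.2 ∧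
      ∀ᶠ z' in 𝓝 z, 0 ≤ z'.1 → (z' ∈ Z ↔ γ z'.1 = z'.2))
    {s₀ : ℝ} (hs₀ : 0 ≤ s₀) (h1 : ∃! e, (s₀, e) ∈ Z) {s : ℝ} (hs : 0 ≤ s) :
    ∃! e, (s, e) ∈ Z := by
  refine (isPreconnected_Ici.induction₂ (s := Set.Ici (0 : ℝ))
    (fun x y => (∃! e, (x, e) ∈ Z) ↔ ∃! e, (y, e) ∈ Z) ?_ ?_ ?_ hs₀ hs).1 h1
  · intro x hx
    by_cases hex : ∃ e, (x, e) ∈ Z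
    · obtain ⟨e, he⟩ := hex
      obtain ⟨γ, hγ, hγe, hγZ⟩ := hloc _ he
      -- One point in the fibre: by properness nearby fibres lie in the neighbourhood where `Z` is
      -- the graph of `γ`. Two points: the two graphs stay distinct nearby. The empty fibre is
      -- treated last, again by properness.
      by_cases hu : ∀ e', (x, e') ∈ Z → e' = e
      · have hU := eventually_fiber_subset hc (isOpen_interior
          (s := {z' : ℝ × E | 0 ≤ z'.1 → (z' ∈ Z ↔ γ z'.1 = z'.2)})) (s := x) (by
            intro e' he'
            rw [hu e' he']
            exact mem_interior_iff_mem_nhds.2 hγZ)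
        filter_upwards [nhdsWithin_le_nhds hU, eventually_graph_mem hγ hγe hγZ,
          self_mem_nhdsWithin] with y hy1 hy2 hy3
        refine iff_of_true ⟨e, he, hu⟩ ⟨γ y, hy2, fun e' he' => ?_⟩
        exact ((interior_subset (hy1 e' he') hy3).1 he').symm
      · push Not at hu
        obtain ⟨e', he', hne⟩ := hu
        obtain ⟨γ', hγ', hγe', hγZ'⟩ := hloc _ he'
        have hne' : ∀ᶠ y in 𝓝 x, γ' y ≠ γ y := by
          refine (hγ'.ne_iff_eventually_ne hγ).1 ?_
          simpa [hγe, hγe'] using hne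
        filter_upwards [nhdsWithin_le_nhds hne', eventually_graph_mem hγ hγe hγZ,
          eventually_graph_mem hγ' hγe' hγZ'] with y hy1 hy2 hy3
        exact iff_of_false (fun h => hne (h.unique he' he)) fun h => hy1 (h.unique hy3 hy2)
    · have hU := eventually_fiber_subset hc isOpen_empty (s := x)
        (fun e he => (hex ⟨e, he⟩).elim)
      filter_upwards [nhdsWithin_le_nhds hU] with y hy
      exact iff_of_false (fun h => hex h.exists) fun h => (hy _ h.exists.choose_spec).elim
  · intro x y z _ _ _ h h'
    exact h.trans h'
  · intro x y _ _ h
    exact h.symm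

/-! ### The level curves of the first integral -/

/-- In the coordinates `u = e^x (h_x - h) / 2`, `v = e^{-x} (h_x + h) / 2`, `s = e^{2x}`: the part
of the level set `c` of the first integral of the Principal equation on which `Ae - v (4uv + A2)`
and `h0` have opposite signs. -/
def levelCurve (Ae A2 h0 c : ℝ) : Set (ℝ × ℝ × ℝ) :=
  {z | 0 ≤ z.1 ∧ 0 ≤ 4 * z.2.1 * z.2.2 + A2 ∧
    (z.2.1 + z.1 * z.2.2) * (4 * z.2.1 * z.2.2 + A2) = Ae * (1 + z.1) ∧
    Ae * (z.2.1 + z.2.2) - (4 * z.2.1 * z.2.2 + A2) ^ 2 / 8 = c ∧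
    h0 * (Ae - z.2.2 * (4 * z.2.1 * z.2.2 + A2)) ≤ 0}

/-- The value `c` of the first integral is not taken at a singular point of its level set. -/
def IsRegularLevel (Ae A2 c : ℝ) : Prop :=
  ∀ u : ℝ, 0 < u → u * (4 * u * u + A2) = Ae → Ae * (u + u) - (4 * u * u + A2) ^ 2 / 8 ≠ c

section LevelCurve

variable {Ae A2 h0 c s u v : ℝ}

lemma pos_of_mem_levelCurve (hAe : 0 < Ae) (h : (s, u, v) ∈ levelCurve Ae A2 h0 c) :
    0 < 4 * u * v + A2 ∧ 0 < u + s * v := by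
  obtain ⟨h1, h2, h3, -⟩ := h
  dsimp only at h1 h2 h3
  have h4 : 0 < (u + s * v) * (4 * u * v + A2) := by rw [h3]; positivity
  have h5 : 0 < 4 * u * v + A2 := lt_of_le_of_ne h2 fun h => by simp [← h] at h4
  exact ⟨h5, pos_of_mul_pos_left h4 h5.le⟩

/-- If `v D = Ae` for `D = 4uv + A2`, the relation `(u + s v) D = Ae (1 + s)` forces `u D = Ae` as
well, so `u = v`, which is a singular point of the kind that `IsRegularLevel` excludes. This is what
lets the weak inequality in `levelCurve`, chosen to be a closed condition, be also an open one. -/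
lemma ne_of_mem_levelCurve (hAe : 0 < Ae) (hc : IsRegularLevel Ae A2 c)
    (h : (s, u, v) ∈ levelCurve Ae A2 h0 c) : Ae - v * (4 * u * v + A2) ≠ 0 := by
  intro h0
  obtain ⟨hD, hP⟩ := pos_of_mem_levelCurve hAe h
  obtain ⟨-, -, h3, h4, -⟩ := h
  dsimp only at h3 h4
  have h5 : u = v := by
    have : (u - v) * (4 * u * v + A2) = 0 := by linear_combination h3 + (1 + s) * h0
    rcases mul_eq_zero.1 this with h | h
    · linarith
    · exact absurd h hD.ne'
  subst h5
  refine hc u ?_ (by linarith) h4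
  have : 0 < u * (4 * u * u + A2) := by linarith
  exact pos_of_mul_pos_left this hD.le

/-- Up to sign, the Jacobian of `levelMap` in `(u, v)` is this quantity times `Ae - v D`. It is also
the coefficient of `v'` in the differential equation for `v`. -/
lemma det_ne_zero_of_mem_levelCurve (hAe : 0 < Ae)
    (h : (s, u, v) ∈ levelCurve Ae A2 h0 c) :
    2 * s * (4 * u * v + A2) + 4 * (u + s * v) ^ 2 ≠ 0 := by
  obtain ⟨hD, hP⟩ := pos_of_mem_levelCurve hAe h
  have h1 : 0 ≤ s := h.1
  positivity

/-- The heart of properness: a large `D = 4uv + A2` would make `u` and `v` positive and contradict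
either the relation `(u + s v) D = Ae (1 + s)` or the value of the first integral. -/
lemma bound_of_mem_levelCurve (hAe : 0 < Ae) {N : ℝ} (h : (s, u, v) ∈ levelCurve Ae A2 h0 c)
    (hs : s ≤ N) :
    4 * u * v + A2 ≤ 2 * |A2| + 1 + 8 * Ae ^ 2 * (1 + N) ^ 2 + (3 * |A2| + 14 * |c|) := by
  obtain ⟨hD, hP⟩ := pos_of_mem_levelCurve hAe h
  obtain ⟨h1, -, h3, h4, -⟩ := h
  dsimp only at h1 h3 h4
  have hA := abs_nonneg A2
  have hA' := le_abs_self A2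
  have hcc := le_abs_self c
  have hc0 := abs_nonneg c
  by_contra! hlt
  set D := 4 * u * v + A2 with hDdef
  have hN : 0 ≤ 8 * Ae ^ 2 * (1 + N) ^ 2 := by positivity
  have hD1 : 1 ≤ D := by linarith
  have hD2 : D ≤ 2 * (D - A2) := by linarith
  have huv : 0 < u * v := by linarith
  have hv : 0 < v := by
    rcases lt_trichotomy v 0 with hv | hv | hv
    · have hu : u < 0 := by nlinarith
      nlinarith
    · simp [hv] at huv
    · exact hv
  have hu : 0 < u := pos_of_mul_pos_left huv hv.le
  -- Away from `s = 0`, the inequality `4 u (s v) ≤ (u + s v)²` and the relation bound `D`. Near `s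
  -- = 0` only `u D ≤ 5 Ae / 4` is available; then `Ae v ≥ D (D - A2) / 5`, which outgrows the `D² /
  -- 8` in the first integral. Any threshold below `1` would leave such a margin.
  rcases le_total (1 / 4) s with h5 | h5
  · have h6 : s * (D - A2) ≤ (u + s * v) ^ 2 := by
      have : s * (D - A2) = 4 * u * (s * v) := by rw [hDdef]; ring
      nlinarith [sq_nonneg (u - s * v)]
    have h7 : D ^ 2 * (s * (D - A2)) ≤ (Ae * (1 + s)) ^ 2 := by
      rw [← h3, mul_pow, mul_comm (D ^ 2)]
      gcongr
    have h8 : (Ae * (1 + s)) ^ 2 ≤ (Ae * (1 + N)) ^ 2 := by gcongr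
    have h9 : D / 8 ≤ s * (D - A2) := by nlinarith
    have h10 : D / 8 ≤ D ^ 2 * (s * (D - A2)) := by nlinarith
    nlinarith
  · have h6 : u * D ≤ Ae * (5 / 4) := by nlinarith [mul_nonneg h1 (mul_pos hv hD).le]
    have h7 : D * (D - A2) ≤ 5 * (Ae * v) := by
      have : D * (D - A2) = 4 * (u * D) * v := by rw [hDdef]; ring
      nlinarith
    have h8 : 0 < Ae * u := by positivity
    nlinarith

lemma isClosed_levelCurve : IsClosed (levelCurve Ae A2 h0 c) := by
  simp only [levelCurve, Set.ofPred_and]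
  exact (isClosed_le (by fun_prop) (by fun_prop)).inter <|
    (isClosed_le (by fun_prop) (by fun_prop)).inter <|
    (isClosed_eq (by fun_prop) (by fun_prop)).inter <|
    (isClosed_eq (by fun_prop) (by fun_prop)).inter (isClosed_le (by fun_prop) (by fun_prop))

/-- The level bounds `u + v`, and `D > 0` bounds `u v` from below, so `u² + v² = (u + v)² - 2uv` is
bounded. -/
lemma abs_le_of_level {B : ℝ} (hAe : 0 < Ae) (hD : 0 < 4 * u * v + A2)
    (hDB : 4 * u * v + A2 ≤ B) (h : Ae * (u + v) - (4 * u * v + A2) ^ 2 / 8 = c) :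
    |u| ≤ ((|c| + B ^ 2 / 8) / Ae) ^ 2 + |A2| + 1 ∧
      |v| ≤ ((|c| + B ^ 2 / 8) / Ae) ^ 2 + |A2| + 1 := by
  have h5 : |u + v| ≤ (|c| + B ^ 2 / 8) / Ae := by
    rw [le_div_iff₀ hAe, show |u + v| * Ae = |(u + v) * Ae| by rw [abs_mul, abs_of_pos hAe]]
    have : (u + v) * Ae = c + (4 * u * v + A2) ^ 2 / 8 := by linear_combination h
    rw [this]
    refine (abs_add_le _ _).trans ?_
    rw [abs_of_nonneg (by positivity : 0 ≤ (4 * u * v + A2) ^ 2 / 8)]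
    gcongr
  generalize (|c| + B ^ 2 / 8) / Ae = R at h5 ⊢
  have h6 : (u + v) ^ 2 ≤ R ^ 2 := by
    rw [← sq_abs]; gcongr
  have h7 : u ^ 2 + v ^ 2 ≤ R ^ 2 + |A2| := by
    have := le_abs_self A2
    nlinarith [abs_nonneg A2]
  generalize R ^ 2 + |A2| = Q at h7 ⊢
  have h8 : 0 ≤ Q := (by positivity : 0 ≤ u ^ 2 + v ^ 2).trans h7
  exact ⟨abs_le_of_sq_le_sq (by nlinarith [sq_nonneg v]) (by linarith),
    abs_le_of_sq_le_sq (by nlinarith [sq_nonneg u]) (by linarith)⟩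

lemma isCompact_levelCurve (hAe : 0 < Ae) (N : ℝ) :
    IsCompact (levelCurve Ae A2 h0 c ∩ {z | z.1 ≤ N}) := by
  refine Metric.isCompact_of_isClosed_isBounded
    (isClosed_levelCurve.inter (isClosed_le (by fun_prop) (by fun_prop))) ?_
  obtain ⟨Q, hQ⟩ : ∃ Q : ℝ, ∀ s u v : ℝ, (s, u, v) ∈ levelCurve Ae A2 h0 c → s ≤ N →
      |u| ≤ Q ∧ |v| ≤ Q := ⟨_, fun s u v hz hs =>
    abs_le_of_level hAe (pos_of_mem_levelCurve hAe hz).1 (bound_of_mem_levelCurve hAe hz hs)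
      hz.2.2.2.1⟩
  refine (Metric.isBounded_Icc ((0, -Q, -Q) : ℝ × ℝ × ℝ) (N, Q, Q)).subset ?_
  rintro ⟨s, u, v⟩ ⟨hz, hs⟩
  obtain ⟨hu, hv⟩ := hQ s u v hz hs
  rw [abs_le] at hu hv
  exact ⟨⟨hz.1, hu.1, hv.1⟩, hs, hu.2, hv.2⟩

end LevelCurve

/-- The left-hand sides of the two equations that define `levelCurve`. -/
noncomputable def levelMap (Ae A2 : ℝ) (z : ℝ × ℝ × ℝ) : ℝ × ℝ :=
  ((z.2.1 + z.1 * z.2.2) * (4 * z.2.1 * z.2.2 + A2) - Ae * (1 + z.1),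
    Ae * (z.2.1 + z.2.2) - (4 * z.2.1 * z.2.2 + A2) ^ 2 / 8)

lemma contDiff_levelMap (Ae A2 : ℝ) : ContDiff ℝ ω (levelMap Ae A2) := by
  unfold levelMap
  fun_prop

lemma hasFDerivAt_levelMap_snd (Ae A2 s u v : ℝ) (w : ℝ × ℝ) :
    (fderiv ℝ (levelMap Ae A2) (s, u, v) ∘L .inr ℝ ℝ (ℝ × ℝ)) w =
      ((w.1 + s * w.2) * (4 * u * v + A2) + (u + s * v) * (4 * (v * w.1 + u * w.2)),
        (Ae - v * (4 * u * v + A2)) * w.1 + (Ae - u * (4 * u * v + A2)) * w.2) := by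
  have h1 : HasFDerivAt (fun z : ℝ × ℝ × ℝ => z.1) (.fst ℝ ℝ (ℝ × ℝ)) (s, u, v) :=
    hasFDerivAt_fst
  have h2 : HasFDerivAt (fun z : ℝ × ℝ × ℝ => z.2.1)
      ((ContinuousLinearMap.fst ℝ ℝ ℝ).comp (.snd ℝ ℝ (ℝ × ℝ))) (s, u, v) :=
    HasFDerivAt.comp _ hasFDerivAt_fst hasFDerivAt_snd
  have h3 : HasFDerivAt (fun z : ℝ × ℝ × ℝ => z.2.2)
      ((ContinuousLinearMap.snd ℝ ℝ ℝ).comp (.snd ℝ ℝ (ℝ × ℝ))) (s, u, v) :=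
    HasFDerivAt.comp _ hasFDerivAt_snd hasFDerivAt_snd
  have hD := ((h2.const_mul 4).mul h3).add_const A2
  have h := (((h2.add (h1.mul h3)).mul hD).sub ((h1.const_add 1).const_mul Ae)).prodMk
    (((h2.add h3).const_mul Ae).sub ((hD.pow 2).mul_const (8 : ℝ)⁻¹))
  have h' : HasFDerivAt (levelMap Ae A2) _ (s, u, v) := h
  rw [h'.fderiv]
  ext
  · simp
    ring
  · simp
    ring

section LevelCurve

variable {Ae A2 h0 c s u v : ℝ}

lemma mem_levelCurve_iff {z : ℝ × ℝ × ℝ} :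
    z ∈ levelCurve Ae A2 h0 c ↔ 0 ≤ z.1 ∧ 0 ≤ 4 * z.2.1 * z.2.2 + A2 ∧
      levelMap Ae A2 z = (0, c) ∧ h0 * (Ae - z.2.2 * (4 * z.2.1 * z.2.2 + A2)) ≤ 0 := by
  simp only [levelCurve, levelMap, Prod.mk.injEq, sub_eq_zero, Set.mem_ofPred_eq, and_assoc]

/-- On the curve `Ae - u D = -s (Ae - v D)`, so the differential of the first integral is a nonzero
multiple of `(1, -s)`. A kernel vector thus has `a = s b`, and the other equation becomes the
nonvanishing factor of `det_ne_zero_of_mem_levelCurve` times `b`. -/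
lemma isInvertible_of_mem_levelCurve (hAe : 0 < Ae) (hc : IsRegularLevel Ae A2 c)
    (h : (s, u, v) ∈ levelCurve Ae A2 h0 c) :
    (fderiv ℝ (levelMap Ae A2) (s, u, v) ∘L .inr ℝ ℝ (ℝ × ℝ)).IsInvertible := by
  set L := fderiv ℝ (levelMap Ae A2) (s, u, v) ∘L .inr ℝ ℝ (ℝ × ℝ) with hL
  have hinj : Function.Injective L := by
    rw [injective_iff_map_eq_zero]
    rintro ⟨a, b⟩ hw
    rw [hL, hasFDerivAt_levelMap_snd] at hw
    simp only [Prod.mk_eq_zero] at hw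
    obtain ⟨h1, h2⟩ := hw
    have h3 := h.2.2.1
    dsimp only at h3
    have h4 := ne_of_mem_levelCurve hAe hc h
    have h5 := det_ne_zero_of_mem_levelCurve hAe h
    have h6 : (Ae - v * (4 * u * v + A2)) * (a - s * b) = 0 := by
      linear_combination h2 + b * h3
    have h7 : a = s * b := by
      rcases mul_eq_zero.1 h6 with h | h
      · exact absurd h h4
      · linarith
    have h8 : (2 * s * (4 * u * v + A2) + 4 * (u + s * v) ^ 2) * b = 0 := by
      rw [h7] at h1
      linear_combination h1
    have h9 : b = 0 := (mul_eq_zero.1 h8).resolve_left h5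
    simp [h7, h9]
  exact ⟨(LinearEquiv.ofInjectiveEndo L.toLinearMap hinj).toContinuousLinearEquiv, by ext <;> rfl⟩

lemma levelCurve_local_graph (hAe : 0 < Ae) (hh0 : h0 ≠ 0) (hc : IsRegularLevel Ae A2 c)
    {z : ℝ × ℝ × ℝ} (hz : z ∈ levelCurve Ae A2 h0 c) :
    ∃ γ : ℝ → ℝ × ℝ, ContDiffAt ℝ ω γ z.1 ∧ γ z.1 = z.2 ∧
      (∀ᶠ z' in 𝓝 z, 0 ≤ z'.1 → (z' ∈ levelCurve Ae A2 h0 c ↔ γ z'.1 = z'.2)) ∧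
      ∀ᶠ s in 𝓝 z.1, levelMap Ae A2 (s, γ s) = (0, c) := by
  obtain ⟨s, u, v⟩ := z
  have hcd := (contDiff_levelMap Ae A2).contDiffAt (x := (s, u, v))
  have hinv := isInvertible_of_mem_levelCurve hAe hc hz
  have hzc : levelMap Ae A2 (s, u, v) = (0, c) := (mem_levelCurve_iff.1 hz).2.2.1
  obtain ⟨hD, hP⟩ := pos_of_mem_levelCurve hAe hz
  have hσ : h0 * (Ae - v * (4 * u * v + A2)) < 0 :=
    lt_of_le_of_ne hz.2.2.2.2 (mul_ne_zero hh0 (ne_of_mem_levelCurve hAe hc hz))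
  refine ⟨hcd.implicitFunction (by simp) hinv, hcd.contDiffAt_implicitFunction (by simp) hinv,
    hcd.implicitFunction_apply_self (by simp) hinv, ?_, ?_⟩
  · have e1 : ∀ᶠ z' : ℝ × ℝ × ℝ in 𝓝 (s, u, v), 0 < 4 * z'.2.1 * z'.2.2 + A2 :=
      ContinuousAt.eventually_lt (by fun_prop) (by fun_prop) hD
    -- Both inequalities are strict at the point, so near it membership with `0 ≤ s` reduces to the
    -- two equations solved by the implicit function.
    have e2 : ∀ᶠ z' : ℝ × ℝ × ℝ in 𝓝 (s, u, v),
        h0 * (Ae - z'.2.2 * (4 * z'.2.1 * z'.2.2 + A2)) < 0 :=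
      ContinuousAt.eventually_lt (by fun_prop) (by fun_prop) hσ
    filter_upwards [e1, e2, hcd.eventually_apply_eq_iff_implicitFunction (by simp) hinv]
      with z' h1 h2 h3 h4
    rw [mem_levelCurve_iff, ← h3, hzc]
    exact ⟨fun h => h.2.2.1, fun h => ⟨h4, h1.le, h, h2.le⟩⟩
  · filter_upwards [hcd.eventually_apply_implicitFunction (by simp) hinv] with s' hs'
    rw [hs', hzc]

end LevelCurve

/-- The functions `u`, `v` of `s = t²` which describe a solution `h(t) = t v(t²) - u(t²) / t` of the
Principal equation near `t = 0`, and on `(0, ∞)`. -/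
structure RadialData (Ae A2 : ℝ) (u v : ℝ → ℝ) : Prop where
  analyticAt_left : ∀ s, 0 ≤ s → AnalyticAt ℝ u s
  analyticAt_right : ∀ s, 0 ≤ s → AnalyticAt ℝ v s
  pos : ∀ s, 0 ≤ s → 0 < 4 * u s * v s + A2
  eqn : ∀ s, 0 ≤ s → (u s + s * v s) * (4 * u s * v s + A2) = Ae * (1 + s)
  deriv_left : ∀ s, 0 ≤ s → deriv u s = s * deriv v s
  deriv_right : ∀ s, 0 ≤ s → deriv v s * (2 * s * (4 * u s * v s + A2) + 4 * (u s + s * v s) ^ 2) =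
    Ae - v s * (4 * u s * v s + A2)

/-- The unique fibre points depend analytically on `s`, and differentiating the two defining
equations along them gives back the differential equations for `u` and `v`. -/
lemma RadialData.of_levelCurve {Ae A2 h0 c : ℝ} (hAe : 0 < Ae) (hh0 : h0 ≠ 0)
    (hc : IsRegularLevel Ae A2 c) (h1 : ∃! e, (1, e) ∈ levelCurve Ae A2 h0 c) :
    ∃ u v : ℝ → ℝ, RadialData Ae A2 u v ∧
      ∀ s, 0 ≤ s → ∀ e, (s, e) ∈ levelCurve Ae A2 h0 c ↔ e = (u s, v s) := by
  have hloc := fun z (hz : z ∈ levelCurve Ae A2 h0 c) => levelCurve_local_graph hAe hh0 hc hz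
  have hfib : ∀ s : ℝ, 0 ≤ s → ∃! e, (s, e) ∈ levelCurve Ae A2 h0 c := fun s hs =>
    existsUnique_fiber (isCompact_levelCurve hAe) (fun z hz => by
      obtain ⟨γ, h1, h2, h3, -⟩ := hloc z hz
      exact ⟨γ, h1.continuousAt, h2, h3⟩) zero_le_one h1 hs
  choose! w hw hwu using hfib
  obtain ⟨γ₀, hγ₀, hγ₀e, hγ₀Z, hγ₀c⟩ := hloc _ (hw 0 le_rfl)
  -- Analyticity at `s = 0` needs values on both sides, so for `s < 0` the fibre point is replaced
  -- by the implicit function `γ₀` based at `s = 0`.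
  set W : ℝ → ℝ × ℝ := fun s => if 0 ≤ s then w s else γ₀ s with hW
  have hWw : ∀ s, 0 ≤ s → W s = w s := fun s hs => by simp [hW, hs]
  have hmem : ∀ s, 0 ≤ s → (s, W s) ∈ levelCurve Ae A2 h0 c := fun s hs => by
    rw [hWw s hs]; exact hw s hs
  have huniq : ∀ s, 0 ≤ s → ∀ e, (s, e) ∈ levelCurve Ae A2 h0 c → e = W s := fun s hs e he => by
    rw [hWw s hs]; exact hwu s hs e he
  have key : ∀ s, 0 ≤ s → ContDiffAt ℝ ω W s ∧ ∀ᶠ r in 𝓝 s, levelMap Ae A2 (r, W r) = (0, c) := by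
    intro s hs
    obtain ⟨γ, h1, h2, h3, h4, h5⟩ : ∃ γ : ℝ → ℝ × ℝ, ContDiffAt ℝ ω γ s ∧ γ s = W s ∧
        (∀ᶠ z' in 𝓝 (s, W s), 0 ≤ z'.1 → (z' ∈ levelCurve Ae A2 h0 c ↔ γ z'.1 = z'.2)) ∧
        (∀ᶠ r in 𝓝 s, levelMap Ae A2 (r, γ r) = (0, c)) ∧ ∀ᶠ r in 𝓝 s, r < 0 → W r = γ r := by
      rcases hs.eq_or_lt with rfl | hs'
      · rw [hWw 0 le_rfl]
        exact ⟨γ₀, hγ₀, hγ₀e, hγ₀Z, hγ₀c, .of_forall fun r hr => by simp [hW, not_le.2 hr]⟩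
      · obtain ⟨γ, h1, h2, h3, h4⟩ := hloc _ (hmem s hs)
        refine ⟨γ, h1, h2, h3, h4, ?_⟩
        filter_upwards [lt_mem_nhds hs'] with r hr hr'
        exact absurd hr hr'.not_gt
    have hEq : W =ᶠ[𝓝 s] γ := by
      have := eventually_graph_mem (z := (s, W s)) h1.continuousAt h2 h3
      rw [eventually_nhdsWithin_iff] at this
      filter_upwards [this, h5] with r hr1 hr2
      rcases le_or_gt 0 r with hr | hr
      · exact (huniq r hr _ (hr1 hr)).symm
      · exact hr2 hr
    refine ⟨h1.congr_of_eventuallyEq hEq, ?_⟩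
    filter_upwards [hEq, h4] with r hr1 hr2
    rw [hr1, hr2]
  have han : ∀ s, 0 ≤ s → AnalyticAt ℝ (fun r => (W r).1) s ∧ AnalyticAt ℝ (fun r => (W r).2) s :=
    fun s hs => ⟨(contDiffAt_fst.comp s (key s hs).1).analyticAt,
      (contDiffAt_snd.comp s (key s hs).1).analyticAt⟩
  have hder : ∀ s, 0 ≤ s → deriv (fun r => (W r).1) s = s * deriv (fun r => (W r).2) s ∧
      deriv (fun r => (W r).2) s * (2 * s * (4 * (W s).1 * (W s).2 + A2)
        + 4 * ((W s).1 + s * (W s).2) ^ 2) = Ae - (W s).2 * (4 * (W s).1 * (W s).2 + A2) := by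
    intro s hs
    have hu := (han s hs).1.differentiableAt.hasDerivAt
    have hv := (han s hs).2.differentiableAt.hasDerivAt
    have hD := ((hu.const_mul 4).mul hv).add_const A2
    have hE := ((hu.add ((hasDerivAt_id s).mul hv)).mul hD).sub
      (((hasDerivAt_id s).const_add 1).const_mul Ae)
    have hΦ := ((hu.add hv).const_mul Ae).sub ((hD.pow 2).div_const 8)
    have e1 := hE.unique ((hasDerivAt_const s (0 : ℝ)).congr_of_eventuallyEq (by
      filter_upwards [(key s hs).2] with r hr
      exact congrArg Prod.fst hr))
    have e2 := hΦ.unique ((hasDerivAt_const s c).congr_of_eventuallyEq (by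
      filter_upwards [(key s hs).2] with r hr
      exact congrArg Prod.snd hr))
    simp only [Pi.add_apply, Pi.mul_apply, id_eq] at e1 e2
    have h3 := (hmem s hs).2.2.1
    dsimp only at h3
    have h4 := ne_of_mem_levelCurve hAe hc (hmem s hs)
    dsimp only at h4
    -- The derivative of the first integral factors as `(Ae - v D)(u' - s v')`, and the first factor
    -- does not vanish.
    have e3 : deriv (fun r => (W r).1) s = s * deriv (fun r => (W r).2) s := by
      have : (Ae - (W s).2 * (4 * (W s).1 * (W s).2 + A2)) *
          (deriv (fun r => (W r).1) s - s * deriv (fun r => (W r).2) s) = 0 := by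
        linear_combination e2 + deriv (fun r => (W r).2) s * h3
      exact sub_eq_zero.1 ((mul_eq_zero.1 this).resolve_left h4)
    refine ⟨e3, ?_⟩
    rw [e3] at e1
    linear_combination e1
  refine ⟨fun s => (W s).1, fun s => (W s).2, ⟨fun s hs => (han s hs).1, fun s hs => (han s hs).2,
    fun s hs => (pos_of_mem_levelCurve hAe (hmem s hs)).1, fun s hs => (hmem s hs).2.2.1,
    fun s hs => (hder s hs).1, fun s hs => (hder s hs).2⟩, fun s hs e => ?_⟩
  exact ⟨huniq s hs e, fun h => h ▸ hmem s hs⟩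

/-! ### Initial data at `t = 1`, and the exchange of `0` and `∞` -/

lemma exists_pos_root {Ae : ℝ} (hAe : 0 < Ae) (b : ℝ) :
    ∃ p, 0 < p ∧ p * (p ^ 2 + b) = 2 * Ae := by
  have hb := abs_nonneg b
  have hb' := neg_abs_le b
  set M := 1 + 2 * Ae + |b| with hM
  have hM0 : 0 ≤ M := by positivity
  have hc : ContinuousOn (fun p : ℝ => p * (p ^ 2 + b)) (Set.Icc 0 M) := by fun_prop
  obtain ⟨p, hp, hpe⟩ := intermediate_value_Icc hM0 hc (show 2 * Ae ∈ Set.Icc _ _ by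
    refine ⟨by simp; linarith, ?_⟩
    have h1 : 1 ≤ M ^ 2 + b := by nlinarith
    nlinarith)
  refine ⟨p, lt_of_le_of_ne hp.1 ?_, hpe⟩
  rintro rfl
  simp at hpe
  linarith

/-- With `p D` fixed, a larger `p` means a smaller `D`, so `Ae p - D² / 8` is strictly increasing in
`p`. Applied with `p = u + v` at `s = 1`, it shows that the level determines `u + v`. -/
lemma eq_of_mul_eq_of_level_eq {Ae p q D E : ℝ} (hAe : 0 < Ae) (hq : 0 < q)
    (hD : 0 < D) (hE : 0 < E) (h : p * D = q * E) (h' : Ae * p - D ^ 2 / 8 = Ae * q - E ^ 2 / 8) :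
    p = q := by
  rcases lt_trichotomy p q with hlt | heq | hlt
  · have h1 : E < D := by
      by_contra! h2
      nlinarith
    nlinarith
  · exact heq
  · have h1 : D < E := by
      by_contra! h2
      nlinarith
    nlinarith

section Initial

variable {Ae A2 h0 p : ℝ}

/-- A singular point satisfies the relation at `s = 1` too. On the same level it would have `u + u =
p`, and comparing the two relations gives `p h0² = 0`. -/
lemma isRegularLevel_initial (hAe : 0 < Ae) (hh0 : h0 ≠ 0) (hp : 0 < p)
    (hpe : p * (p ^ 2 - h0 ^ 2 + A2) = 2 * Ae) :
    IsRegularLevel Ae A2 (Ae * p - (p ^ 2 - h0 ^ 2 + A2) ^ 2 / 8) := by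
  intro u hu hue hc
  have hD : 0 < p ^ 2 - h0 ^ 2 + A2 := pos_of_mul_pos_right (by rw [hpe]; linarith) hp.le
  have hE : 0 < 4 * u * u + A2 := pos_of_mul_pos_right (by rw [hue]; linarith) hu.le
  have h1 : u + u = p := eq_of_mul_eq_of_level_eq hAe hp hE hD (by linarith) hc
  have h2 : p * h0 ^ 2 = 0 := by
    have h3 : 2 * u = p := by linarith
    rw [← h3] at hpe ⊢
    linear_combination 2 * hue - hpe
  simp [hp.ne', hh0] at h2

/-- At `s = 1` the level fixes `u + v = p`, the relation then fixes `(u - v)² = h0²`, and the sign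
condition, there equivalent to `h0 (u - v) ≤ 0`, selects `u - v = -h0`. -/
lemma existsUnique_initial (hAe : 0 < Ae) (hh0 : h0 ≠ 0) (hp : 0 < p)
    (hpe : p * (p ^ 2 - h0 ^ 2 + A2) = 2 * Ae) (e : ℝ × ℝ) :
    (1, e) ∈ levelCurve Ae A2 h0 (Ae * p - (p ^ 2 - h0 ^ 2 + A2) ^ 2 / 8) ↔
      e = ((p - h0) / 2, (p + h0) / 2) := by
  have hD : 0 < p ^ 2 - h0 ^ 2 + A2 := pos_of_mul_pos_right (by rw [hpe]; linarith) hp.le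
  constructor
  · intro h
    obtain ⟨u, v⟩ := e
    obtain ⟨hE, hP⟩ := pos_of_mem_levelCurve hAe h
    obtain ⟨-, -, h3, h4, h5⟩ := h
    dsimp only at h3 h4 h5
    rw [one_mul] at hP h3
    have h6 : u + v = p := eq_of_mul_eq_of_level_eq hAe hp hE hD (by linarith) h4
    have h7 : p * ((u - v - h0) * (u - v + h0)) = 0 := by
      rw [← h6] at hpe ⊢
      linear_combination hpe - h3
    have h8 : h0 * (u - v) ≤ 0 := by
      have : h0 * (u - v) * (4 * u * v + A2) ≤ 0 := by
        have h9 : 2 * Ae = (u + v) * (4 * u * v + A2) := by linarith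
        have h10 : h0 * (u - v) * (4 * u * v + A2) = 2 * (h0 * (Ae - v * (4 * u * v + A2))) := by
          linear_combination -h0 * h9
        linarith
      exact nonpos_of_mul_nonpos_left this hE
    have h9 : u - v + h0 = 0 := by
      rcases mul_eq_zero.1 ((mul_eq_zero.1 h7).resolve_left hp.ne') with h | h
      · rw [show u - v = h0 by linarith] at h8
        exact absurd (le_antisymm h8 (mul_self_nonneg h0)) (by simpa using hh0)
      · exact h
    ext <;> dsimp only <;> linarith
  · rintro rfl
    have hDe : 4 * ((p - h0) / 2) * ((p + h0) / 2) + A2 = p ^ 2 - h0 ^ 2 + A2 := by ring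
    refine ⟨zero_le_one, ?_, ?_, ?_, ?_⟩ <;> dsimp only <;> rw [hDe]
    · exact hD.le
    · linear_combination hpe
    · ring
    · have : h0 * (Ae - (p + h0) / 2 * (p ^ 2 - h0 ^ 2 + A2))
          = -(h0 ^ 2 * (p ^ 2 - h0 ^ 2 + A2) / 2) := by linear_combination (-h0 / 2) * hpe
      rw [this, neg_nonpos]
      positivity

end Initial

lemma levelCurve_swap {Ae A2 h0 c s u v : ℝ} (hs : 0 < s) (h : (s, u, v) ∈ levelCurve Ae A2 h0 c) :
    (s⁻¹, v, u) ∈ levelCurve Ae A2 (-h0) c := by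
  obtain ⟨-, h2, h3, h4, h5⟩ := h
  dsimp only at h2 h3 h4 h5
  have hD : 4 * v * u + A2 = 4 * u * v + A2 := by ring
  refine ⟨(inv_pos.2 hs).le, ?_, ?_, ?_, ?_⟩ <;> dsimp only <;> rw [hD]
  · exact h2
  · field_simp
    linear_combination h3
  · linear_combination h4
  · have : -h0 * (Ae - u * (4 * u * v + A2)) = s * (h0 * (Ae - v * (4 * u * v + A2))) := by
      linear_combination h0 * h3
    rw [this]
    exact mul_nonpos_of_nonneg_of_nonpos hs.le h5

lemma RadialData.const {Ae A2 a : ℝ} (ha : 0 < a) (hAe : 0 < Ae) (h : a * (4 * a * a + A2) = Ae) :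
    RadialData Ae A2 (fun _ => a) (fun _ => a) where
  analyticAt_left _ _ := analyticAt_const
  analyticAt_right _ _ := analyticAt_const
  pos _ _ := pos_of_mul_pos_right (by rw [h]; exact hAe) ha.le
  eqn s _ := by linear_combination (1 + s) * h
  deriv_left _ _ := by simp
  deriv_right _ _ := by simp [h]

/-- The functions describing a solution of the Principal equation near `t = 0` and near
`t = ∞`. -/
structure SphereData (Ae A2 : ℝ) (u v u' v' : ℝ → ℝ) : Prop where
  zero : RadialData Ae A2 u v
  infty : RadialData Ae A2 u' v'
  inv_left : ∀ s, 0 < s → u' s = v s⁻¹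
  inv_right : ∀ s, 0 < s → v' s = u s⁻¹

/-- The data at `∞` come from the same level with `-h0` for `h0`; they match the data at `0` by the
swap symmetry and uniqueness in each fibre. -/
theorem exists_sphereData {Ae : ℝ} (A2 h0 : ℝ) (hAe : 0 < Ae) :
    ∃ u v u' v' : ℝ → ℝ, SphereData Ae A2 u v u' v' ∧ v 1 - u 1 = h0 ∧
      ((h0 = 0 ∧ ∃ a : ℝ, u = (fun _ => a) ∧ v = (fun _ => a) ∧ u' = (fun _ => a) ∧
        v' = fun _ => a) ∨ (h0 ≠ 0 ∧ u 0 * v 0 ≠ u' 0 * v' 0)) := by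
  obtain ⟨p, hp, hpe⟩ := exists_pos_root hAe (-h0 ^ 2 + A2)
  replace hpe : p * (p ^ 2 - h0 ^ 2 + A2) = 2 * Ae := by rw [← hpe]; ring
  by_cases hh0 : h0 = 0
  · subst hh0
    have h := RadialData.const (a := p / 2) (A2 := A2) (by positivity) hAe (by
      linear_combination hpe / 2)
    exact ⟨_, _, _, _, ⟨h, h, fun _ _ => rfl, fun _ _ => rfl⟩, by simp,
      Or.inl ⟨rfl, _, rfl, rfl, rfl, rfl⟩⟩
  · have hreg := isRegularLevel_initial hAe hh0 hp hpe
    have hini := existsUnique_initial hAe hh0 hp hpe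
    have hini' := existsUnique_initial (h0 := -h0) hAe (neg_ne_zero.2 hh0) hp
      (by rw [neg_sq]; exact hpe)
    rw [neg_sq] at hini'
    set c := Ae * p - (p ^ 2 - h0 ^ 2 + A2) ^ 2 / 8
    obtain ⟨u, v, huv, hZ⟩ := RadialData.of_levelCurve hAe hh0 hreg
      ⟨_, (hini _).2 rfl, fun e he => (hini e).1 he⟩
    obtain ⟨u', v', huv', hZ'⟩ := RadialData.of_levelCurve hAe (neg_ne_zero.2 hh0) hreg
      ⟨_, (hini' _).2 rfl, fun e he => (hini' e).1 he⟩
    have hswap : ∀ s, 0 < s → (v s⁻¹, u s⁻¹) = (u' s, v' s) := fun s hs => by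
      have h1 := levelCurve_swap (inv_pos.2 hs) ((hZ s⁻¹ (inv_pos.2 hs).le _).2 rfl)
      rw [inv_inv] at h1
      exact (hZ' s hs.le _).1 h1
    refine ⟨u, v, u', v', ⟨huv, huv', fun s hs => (congrArg Prod.fst (hswap s hs)).symm,
      fun s hs => (congrArg Prod.snd (hswap s hs)).symm⟩, ?_, Or.inr ⟨hh0, fun hw => ?_⟩⟩
    · have h1 := (hini _).1 ((hZ 1 zero_le_one _).2 rfl)
      rw [Prod.mk.injEq] at h1
      rw [h1.1, h1.2]
      ring
    -- If the products `u v` at the two poles agreed, then so would `D`, hence `u` by `u D = Ae` at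
    -- `s = 0`, hence `v`. The sign conditions for `h0` and `-h0` would then force `h0 (Ae - v D) =
    -- 0`.
    · have m := (hZ 0 le_rfl _).2 rfl
      have m' := (hZ' 0 le_rfl _).2 rfl
      have hne := mul_ne_zero hh0 (ne_of_mem_levelCurve hAe hreg m)
      obtain ⟨hD, hP⟩ := pos_of_mem_levelCurve hAe m
      obtain ⟨-, -, h3, -, h5⟩ := m
      obtain ⟨-, -, h3', -, h5'⟩ := m'
      dsimp only at h3 h3' h5 h5'
      have hD' : 4 * u' 0 * v' 0 + A2 = 4 * u 0 * v 0 + A2 := by linear_combination -4 * hw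
      rw [hD'] at h3' h5'
      have hu : u' 0 = u 0 := by
        have : (u' 0 - u 0) * (4 * u 0 * v 0 + A2) = 0 := by linear_combination h3' - h3
        exact sub_eq_zero.1 ((mul_eq_zero.1 this).resolve_right hD.ne')
      have hv : v' 0 = v 0 := by
        rw [hu] at hw
        rw [zero_mul, add_zero] at hP
        exact (mul_left_cancel₀ hP.ne' hw).symm
      rw [hv] at h5'
      exact hne (le_antisymm h5 (by linarith))

/-! ### Uniqueness of the solution -/

/-- The equation forbids a zero of `deriv k`. By Darboux's theorem the derivative keeps its sign
from `t = 1`, although it is not assumed continuous. -/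
lemma IsPrincipalSolution.deriv_pos {Ae A2 h0 : ℝ} (hAe : 0 < Ae) {J : Set ℝ} {k : ℝ → ℝ}
    (hJ : IsPreconnected J) (hJ0 : J ⊆ Set.Ioi 0) (h1 : (1 : ℝ) ∈ J)
    (hk : IsPrincipalSolution Ae A2 h0 J k) {t : ℝ} (ht : t ∈ J) : 0 < deriv k t := by
  obtain ⟨hd, he, -, hp⟩ := hk
  have hne : ∀ t ∈ J, deriv k t ≠ 0 := by
    intro t ht h
    have h2 := he t ht
    have h3 : 0 < t := hJ0 ht
    rw [h] at h2
    have : 0 < Ae * (t + t⁻¹) := by positivity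
    simp at h2
    rcases h2 with h2 | h2
    · exact hAe.ne' h2
    · exact absurd h2 (by positivity)
  rcases hasDerivWithinAt_forall_lt_or_forall_gt_of_forall_ne hJ.ordConnected.convex
    (fun t ht => (hd t ht).hasDerivAt.hasDerivWithinAt) hne with h | h
  · exact absurd (h 1 h1) hp.not_gt
  · exact h t ht

/-- If `p < 1`, the bracket is at most `1 + |A2|`, so `p` cannot be smaller than `Ae / (1 + |A2|)`.
The bound does not depend on `k`. -/
lemma principal_root_lower_bound {Ae A2 k p B : ℝ} (hp : 0 < p) (hB : Ae ≤ B)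
    (h : p * (p ^ 2 - k ^ 2 + A2) - B = 0) : min 1 (Ae / (1 + |A2|)) ≤ p := by
  by_contra! hlt
  obtain ⟨h1, h2⟩ := lt_min_iff.1 hlt
  have hA := abs_nonneg A2
  have hA' := le_abs_self A2
  rw [lt_div_iff₀ (by positivity)] at h2
  have h3 : p ^ 2 - k ^ 2 + A2 ≤ 1 + |A2| := by nlinarith [sq_nonneg k]
  have := mul_le_mul_of_nonneg_left h3 hp.le
  linarith

/-- Lipschitz dependence of the positive root on `k`. Subtracting the equations `p₁ a = B = p₂ b`
gives `(p₁ - p₂)(a + b + (p₁ + p₂)²) = (p₁ + p₂)(k₁ + k₂)(k₁ - k₂)`, and `a`, `b` are positive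
because `B` is. -/
lemma principal_root_sub_le {A2 k₁ k₂ p₁ p₂ B : ℝ} (h1 : 0 < p₁) (h2 : 0 < p₂) (hB : 0 < B)
    (e1 : p₁ * (p₁ ^ 2 - k₁ ^ 2 + A2) - B = 0) (e2 : p₂ * (p₂ ^ 2 - k₂ ^ 2 + A2) - B = 0) :
    |p₁ - p₂| * (p₁ + p₂) ≤ |k₁ + k₂| * |k₁ - k₂| := by
  set a := p₁ ^ 2 - k₁ ^ 2 + A2 with ha
  set b := p₂ ^ 2 - k₂ ^ 2 + A2 with hb
  have ha0 : 0 < a := pos_of_mul_pos_right (by linarith : 0 < p₁ * a) h1.le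
  have hb0 : 0 < b := pos_of_mul_pos_right (by linarith : 0 < p₂ * b) h2.le
  have key : (p₁ - p₂) * (a + b + (p₁ + p₂) ^ 2) = (p₁ + p₂) * ((k₁ + k₂) * (k₁ - k₂)) := by
    rw [ha, hb] at *
    linear_combination 2 * e1 - 2 * e2
  have h3 : |p₁ - p₂| * (a + b + (p₁ + p₂) ^ 2) = (p₁ + p₂) * (|k₁ + k₂| * |k₁ - k₂|) := by
    rw [← abs_mul, ← abs_of_pos (by positivity : 0 < a + b + (p₁ + p₂) ^ 2), ← abs_mul, key,
      abs_mul, abs_of_pos (by positivity : 0 < p₁ + p₂)]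
  have h4 : (p₁ + p₂) * (|p₁ - p₂| * (p₁ + p₂)) ≤ (p₁ + p₂) * (|k₁ + k₂| * |k₁ - k₂|) := by
    rw [← h3]
    nlinarith [mul_nonneg (abs_nonneg (p₁ - p₂)) (add_pos ha0 hb0).le]
  exact le_of_mul_le_mul_left h4 (by positivity)

lemma eq_zero_of_abs_deriv_le_right {f : ℝ → ℝ} {K a b : ℝ}
    (hd : ∀ t ∈ Set.Icc a b, DifferentiableAt ℝ f t) (h0 : f a = 0)
    (hK : ∀ t ∈ Set.Icc a b, |deriv f t| ≤ K * |f t|) {t : ℝ} (ht : t ∈ Set.Icc a b) :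
    f t = 0 := by
  exact eq_zero_of_abs_deriv_le_mul_abs_self_of_eq_zero_right
    (fun t ht => (hd t ht).continuousAt.continuousWithinAt)
    (fun t ht => (hd t (Set.Ico_subset_Icc_self ht)).hasDerivAt.hasDerivWithinAt) h0
    (fun t ht => hK t (Set.Ico_subset_Icc_self ht)) t ht

lemma eq_zero_of_abs_deriv_le_left {f : ℝ → ℝ} {K a b : ℝ}
    (hd : ∀ t ∈ Set.Icc a b, DifferentiableAt ℝ f t) (h0 : f b = 0)
    (hK : ∀ t ∈ Set.Icc a b, |deriv f t| ≤ K * |f t|) {t : ℝ} (ht : t ∈ Set.Icc a b) :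
    f t = 0 := by
  have hm : ∀ r ∈ Set.Icc (-b) (-a), -r ∈ Set.Icc a b := fun r hr =>
    ⟨by linarith [hr.2], by linarith [hr.1]⟩
  have h := eq_zero_of_abs_deriv_le_right (f := fun r => f (-r)) (K := K) (a := -b) (b := -a)
    (fun r hr => (hd _ (hm r hr)).comp r differentiable_neg.differentiableAt) (by simpa using h0)
    (fun r hr => by
      rw [deriv_comp_neg, abs_neg]
      exact hK _ (hm r hr)) (t := -t) ⟨neg_le_neg ht.2, neg_le_neg ht.1⟩
  simpa using h

/-- Positivity of the derivative singles out the positive root `t h_t`. Its Lipschitz dependence on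
`h` bounds the derivative of the difference of two solutions by a multiple of the difference, and
Grönwall applies on either side of `1`. -/
lemma IsPrincipalSolution.eqOn {Ae A2 h0 : ℝ} (hAe : 0 < Ae) {J : Set ℝ} {k₁ k₂ : ℝ → ℝ}
    (hJ : IsPreconnected J) (hJ0 : J ⊆ Set.Ioi 0) (h1 : (1 : ℝ) ∈ J)
    (hk₁ : IsPrincipalSolution Ae A2 h0 J k₁) (hk₂ : IsPrincipalSolution Ae A2 h0 J k₂) :
    Set.EqOn k₁ k₂ J := by
  intro t ht
  set m := min 1 (Ae / (1 + |A2|)) with hm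
  have hm0 : 0 < m := lt_min one_pos (by positivity)
  have hIJ : Set.uIcc 1 t ⊆ J := hJ.ordConnected.uIcc_subset h1 ht
  -- Division of the Lipschitz estimate by `r (p₁ + p₂) ≥ 2 m r` produces this coefficient; its
  -- maximum on the compact interval is the Grönwall constant.
  have hcont : ContinuousOn (fun r => |k₁ r + k₂ r| / (2 * m * r)) (Set.uIcc 1 t) := by
    intro r hr
    have hr0 : 0 < r := hJ0 (hIJ hr)
    have c1 := (hk₁.1 r (hIJ hr)).continuousAt
    have c2 := (hk₂.1 r (hIJ hr)).continuousAt
    exact ((c1.add c2).abs.div (by fun_prop) (by positivity)).continuousWithinAt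
  obtain ⟨K, hK⟩ := isCompact_uIcc.bddAbove_image hcont
  have hbound : ∀ r ∈ Set.uIcc 1 t, |deriv (fun r => k₁ r - k₂ r) r| ≤ K * |k₁ r - k₂ r| := by
    intro r hr
    have hr0 : 0 < r := hJ0 (hIJ hr)
    have hKr : |k₁ r + k₂ r| / (2 * m * r) ≤ K := hK ⟨r, hr, rfl⟩
    have hB : Ae ≤ Ae * (r + r⁻¹) := by
      have : 1 ≤ r + r⁻¹ := by
        rcases le_total 1 r with h | h
        · linarith [inv_pos.2 hr0]
        · linarith [(one_le_inv₀ hr0).2 h]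
      nlinarith
    have p1 := mul_pos hr0 (hk₁.deriv_pos hAe hJ hJ0 h1 (hIJ hr))
    have p2 := mul_pos hr0 (hk₂.deriv_pos hAe hJ hJ0 h1 (hIJ hr))
    have e1 := hk₁.2.1 r (hIJ hr)
    have e2 := hk₂.2.1 r (hIJ hr)
    have m1 := principal_root_lower_bound p1 hB e1
    have m2 := principal_root_lower_bound p2 hB e2
    have hsub := principal_root_sub_le p1 p2 (hAe.trans_le hB) e1 e2
    rw [deriv_fun_sub (hk₁.1 r (hIJ hr)) (hk₂.1 r (hIJ hr))]
    rw [← mul_sub, abs_mul, abs_of_pos hr0] at hsub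
    refine le_trans ?_ (mul_le_mul_of_nonneg_right hKr (abs_nonneg _))
    rw [div_mul_eq_mul_div, le_div_iff₀ (by positivity)]
    refine le_trans ?_ hsub
    have := mul_le_mul_of_nonneg_left (add_le_add m1 m2)
      (mul_nonneg hr0.le (abs_nonneg (deriv k₁ r - deriv k₂ r)))
    rw [← hm] at this
    linarith
  have hd : ∀ r ∈ Set.uIcc 1 t, DifferentiableAt ℝ (fun r => k₁ r - k₂ r) r := fun r hr =>
    (hk₁.1 r (hIJ hr)).sub (hk₂.1 r (hIJ hr))
  have h11 : k₁ 1 - k₂ 1 = 0 := by rw [hk₁.2.2.1, hk₂.2.2.1, sub_self]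
  rw [← sub_eq_zero]
  rcases le_total 1 t with h | h
  · rw [Set.uIcc_of_le h] at hd hbound
    exact eq_zero_of_abs_deriv_le_right (f := fun r => k₁ r - k₂ r) hd h11 hbound ⟨h, le_rfl⟩
  · rw [Set.uIcc_of_ge h] at hd hbound
    exact eq_zero_of_abs_deriv_le_left (f := fun r => k₁ r - k₂ r) hd h11 hbound ⟨le_rfl, h⟩

/-- The solution `h(t) = t v(t²) - u(t²) / t` of the Principal equation. -/
noncomputable def radialSolution (u v : ℝ → ℝ) (t : ℝ) : ℝ := t * v (t ^ 2) - u (t ^ 2) / t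

section Solution

variable {Ae A2 : ℝ} {u v : ℝ → ℝ}

lemma RadialData.hasDerivAt_left (R : RadialData Ae A2 u v) {s : ℝ} (hs : 0 ≤ s) :
    HasDerivAt u (s * deriv v s) s := by
  rw [← R.deriv_left s hs]
  exact (R.analyticAt_left s hs).differentiableAt.hasDerivAt

lemma RadialData.hasDerivAt_right (R : RadialData Ae A2 u v) {s : ℝ} (hs : 0 ≤ s) :
    HasDerivAt v (deriv v s) s :=
  (R.analyticAt_right s hs).differentiableAt.hasDerivAt

/-- The terms containing `u'` and `v'` cancel exactly because `u' = s v'`. -/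
lemma RadialData.hasDerivAt_solution (R : RadialData Ae A2 u v) {t : ℝ} (ht : 0 < t) :
    HasDerivAt (radialSolution u v) (v (t ^ 2) + u (t ^ 2) / t ^ 2) t := by
  have h2 : HasDerivAt (fun t : ℝ => t ^ 2) (2 * t) t := by simpa using hasDerivAt_pow 2 t
  have hu := HasDerivAt.comp (h := fun t : ℝ => t ^ 2) t (R.hasDerivAt_left (sq_nonneg t)) h2
  have hv := HasDerivAt.comp (h := fun t : ℝ => t ^ 2) t (R.hasDerivAt_right (sq_nonneg t)) h2
  have h := ((hasDerivAt_id t).mul hv).sub (hu.div (hasDerivAt_id t) ht.ne')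
  refine HasDerivAt.congr_deriv (f := radialSolution u v) h ?_
  simp only [Function.comp_apply, id_eq]
  field_simp
  ring

lemma RadialData.mul_deriv_solution (R : RadialData Ae A2 u v) {t : ℝ} (ht : 0 < t) :
    t * deriv (radialSolution u v) t = (u (t ^ 2) + t ^ 2 * v (t ^ 2)) / t := by
  rw [(R.hasDerivAt_solution ht).deriv]
  field_simp
  ring

lemma RadialData.eigen_pos (R : RadialData Ae A2 u v) (hAe : 0 < Ae) {s : ℝ} (hs : 0 ≤ s) :
    0 < u s + s * v s :=
  pos_of_mul_pos_left (by rw [R.eqn s hs]; positivity) (R.pos s hs).le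

lemma RadialData.isPrincipalSolution (R : RadialData Ae A2 u v) (hAe : 0 < Ae) :
    IsPrincipalSolution Ae A2 (v 1 - u 1) (Set.Ioi 0) (radialSolution u v) := by
  refine ⟨fun t ht => (R.hasDerivAt_solution ht).differentiableAt, fun t ht => ?_, ?_, ?_⟩
  · have ht : 0 < t := ht
    have h := R.eqn (t ^ 2) (sq_nonneg t)
    rw [R.mul_deriv_solution ht, radialSolution]
    field_simp
    linear_combination h * t ^ 2
  · simp [radialSolution]
  · have h := R.eigen_pos hAe zero_le_one
    rw [(R.hasDerivAt_solution one_pos).deriv]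
    simpa [add_comm] using h

end Solution

/-! ### Conformally flat metrics on the plane -/

lemma partialDeriv_eq_of_hasFDerivAt {f : Plane → ℝ} {f' : Plane →L[ℝ] ℝ} {x : Plane}
    (h : HasFDerivAt f f' x) (i : Fin 2) :
    partialDeriv i f x = f' (EuclideanSpace.single i 1) := by
  rw [partialDeriv, h.fderiv]

lemma hasFDerivAt_coord (i : Fin 2) (x : Plane) :
    HasFDerivAt (fun y : Plane => y i) (EuclideanSpace.proj i : Plane →L[ℝ] ℝ) x :=
  (EuclideanSpace.proj i : Plane →L[ℝ] ℝ).hasFDerivAt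

/-- The matrix of the metric `(dx₀² + dx₁²) / ψ²`. -/
noncomputable def conformalMatrix (ψ : Plane → ℝ) (x : Plane) : Matrix (Fin 2) (Fin 2) ℝ :=
  (ψ x ^ 2)⁻¹ • 1

lemma conformalMatrix_inv {ψ : Plane → ℝ} {x : Plane} (hψ : ψ x ≠ 0) :
    (conformalMatrix ψ x)⁻¹ = ψ x ^ 2 • 1 := by
  refine Matrix.inv_eq_right_inv ?_
  simp [conformalMatrix, smul_smul, hψ]

lemma partialDeriv_conformalMatrix {ψ : Plane → ℝ} {x : Plane} (hψ : ψ x ≠ 0)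
    (hd : DifferentiableAt ℝ ψ x) (k i j : Fin 2) :
    partialDeriv k (fun y => conformalMatrix ψ y i j) x =
      -2 * partialDeriv k ψ x / ψ x ^ 3 * (1 : Matrix (Fin 2) (Fin 2) ℝ) i j := by
  have h := ((hasDerivAt_inv (pow_ne_zero 2 hψ)).comp_hasFDerivAt x
    (hd.hasFDerivAt.pow 2)).mul_const ((1 : Matrix (Fin 2) (Fin 2) ℝ) i j)
  have h' : HasFDerivAt (fun y => conformalMatrix ψ y i j) _ x := h
  rw [partialDeriv_eq_of_hasFDerivAt h', partialDeriv]
  simp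
  field_simp

lemma christoffel_conformalMatrix {ψ : Plane → ℝ} {x : Plane} (hψ : ψ x ≠ 0)
    (hd : DifferentiableAt ℝ ψ x) (k i j : Fin 2) :
    christoffel (conformalMatrix ψ) k i j x =
      -((1 : Matrix (Fin 2) (Fin 2) ℝ) j k * (partialDeriv i ψ x / ψ x)
        + (1 : Matrix (Fin 2) (Fin 2) ℝ) i k * (partialDeriv j ψ x / ψ x)
        - (1 : Matrix (Fin 2) (Fin 2) ℝ) i j * (partialDeriv k ψ x / ψ x)) := by
  simp only [christoffel, conformalMatrix_inv hψ, partialDeriv_conformalMatrix hψ hd,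
    Fin.sum_univ_two, Matrix.smul_apply, smul_eq_mul]
  rcases (show k = 0 ∨ k = 1 by omega) with rfl | rfl <;>
  rcases (show i = 0 ∨ i = 1 by omega) with rfl | rfl <;>
  rcases (show j = 0 ∨ j = 1 by omega) with rfl | rfl <;>
  simp <;> field_simp

lemma partialDeriv_div {f ψ : Plane → ℝ} {x : Plane} (hψ : ψ x ≠ 0) (hf : DifferentiableAt ℝ f x)
    (hd : DifferentiableAt ℝ ψ x) (i : Fin 2) :
    partialDeriv i (fun y => f y / ψ y) x =
      (partialDeriv i f x * ψ x - f x * partialDeriv i ψ x) / ψ x ^ 2 := by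
  have h := hf.hasFDerivAt.mul ((hasDerivAt_inv hψ).comp_hasFDerivAt x hd.hasFDerivAt)
  have h' : HasFDerivAt (fun y => f y / ψ y) _ x := h
  rw [partialDeriv_eq_of_hasFDerivAt h', partialDeriv, partialDeriv]
  simp
  field_simp
  ring

lemma partialDeriv_neg (f : Plane → ℝ) (i : Fin 2) (x : Plane) :
    partialDeriv i (fun y => -f y) x = -partialDeriv i f x := by
  simp [partialDeriv, fderiv_fun_neg]

/-- The classical formula `K = ψ Δψ - |∇ψ|²` for the metric `|dx|² / ψ²`, obtained from the
Christoffel symbols. -/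
theorem gaussCurvature_conformalMatrix {ψ : Plane → ℝ} (hψ : ∀ x, ψ x ≠ 0)
    (hd : Differentiable ℝ ψ) (hdd : ∀ i, Differentiable ℝ (partialDeriv i ψ)) (x : Plane) :
    gaussCurvature (conformalMatrix ψ) x =
      ψ x * (partialDeriv 0 (partialDeriv 0 ψ) x + partialDeriv 1 (partialDeriv 1 ψ) x)
        - partialDeriv 0 ψ x ^ 2 - partialDeriv 1 ψ x ^ 2 := by
  have hΓ : ∀ k i j, christoffel (conformalMatrix ψ) k i j = _ := fun k i j =>
    funext fun y => christoffel_conformalMatrix (hψ y) (hd y) k i j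
  have hx := hψ x
  simp only [gaussCurvature, riemannTensor, hΓ, Fin.sum_univ_two, conformalMatrix]
  simp [partialDeriv_neg, partialDeriv_div hx (hdd _ x) (hd x)]
  field_simp
  ring

/-! ### Rotationally symmetric data -/

/-- The function `|x|²` on the plane. -/
def normSq (x : Plane) : ℝ := x 0 ^ 2 + x 1 ^ 2

lemma normSq_nonneg (x : Plane) : 0 ≤ normSq x := by unfold normSq; positivity

lemma normSq_eq_norm (x : Plane) : normSq x = ‖x‖ ^ 2 := by
  rw [EuclideanSpace.real_norm_sq_eq, Fin.sum_univ_two, normSq]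

lemma hasFDerivAt_normSq (x : Plane) :
    HasFDerivAt normSq ((2 * x 0) • (EuclideanSpace.proj 0 : Plane →L[ℝ] ℝ)
      + (2 * x 1) • (EuclideanSpace.proj 1 : Plane →L[ℝ] ℝ)) x := by
  have h : HasFDerivAt normSq _ x := ((hasFDerivAt_coord 0 x).pow 2).add
    ((hasFDerivAt_coord 1 x).pow 2)
  refine h.congr_fderiv ?_
  ext w
  simp

lemma analyticAt_normSq (x : Plane) : AnalyticAt ℝ normSq x := by
  have h : ContDiff ℝ ω normSq := by unfold normSq; fun_prop
  exact h.contDiffAt.analyticAt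

lemma analyticAt_comp_normSq {b : ℝ → ℝ} (hb : ∀ s, 0 ≤ s → AnalyticAt ℝ b s) (x : Plane) :
    AnalyticAt ℝ (fun y => b (normSq y)) x :=
  (hb _ (normSq_nonneg x)).comp (analyticAt_normSq x)

lemma partialDeriv_comp_normSq {b : ℝ → ℝ} {b' : ℝ} {x : Plane} (hb : HasDerivAt b b' (normSq x))
    (i : Fin 2) : partialDeriv i (fun y => b (normSq y)) x = 2 * x i * b' := by
  rw [partialDeriv_eq_of_hasFDerivAt (f := fun y => b (normSq y))
    (hb.comp_hasFDerivAt x (hasFDerivAt_normSq x))]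
  fin_cases i <;> simp <;> ring

/-- The function `|x| h_x`, in terms of which the metric is `|dx|² / conformalFactor²`. -/
def conformalFactor (u v : ℝ → ℝ) (x : Plane) : ℝ := u (normSq x) + normSq x * v (normSq x)

section Radial

variable {Ae A2 : ℝ} {u v : ℝ → ℝ}

lemma RadialData.conformalFactor_pos (R : RadialData Ae A2 u v) (hAe : 0 < Ae) (x : Plane) :
    0 < conformalFactor u v x := R.eigen_pos hAe (normSq_nonneg x)

lemma RadialData.analyticAt_conformalFactor (R : RadialData Ae A2 u v) (x : Plane) :
    AnalyticAt ℝ (conformalFactor u v) x :=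
  (analyticAt_comp_normSq R.analyticAt_left x).add
    ((analyticAt_normSq x).mul (analyticAt_comp_normSq R.analyticAt_right x))

lemma RadialData.hasDerivAt_factor (R : RadialData Ae A2 u v) {s : ℝ} (hs : 0 ≤ s) :
    HasDerivAt (fun r => u r + r * v r) (v s + 2 * s * deriv v s) s := by
  have h := (R.hasDerivAt_left hs).add ((hasDerivAt_id s).mul (R.hasDerivAt_right hs))
  refine HasDerivAt.congr_deriv (f := fun r => u r + r * v r) h ?_
  simp
  ring

lemma RadialData.partialDeriv_conformalFactor (R : RadialData Ae A2 u v) (i : Fin 2) (x : Plane) :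
    partialDeriv i (conformalFactor u v) x
      = 2 * x i * (v (normSq x) + 2 * normSq x * deriv v (normSq x)) :=
  partialDeriv_comp_normSq (b := fun r => u r + r * v r)
    (R.hasDerivAt_factor (normSq_nonneg x)) i

theorem RadialData.gaussCurvature_eq (R : RadialData Ae A2 u v) (hAe : 0 < Ae) (x : Plane) :
    gaussCurvature (conformalMatrix (conformalFactor u v)) x =
      4 * (conformalFactor u v x * (v (normSq x) + 2 * normSq x * deriv v (normSq x)
        + normSq x * deriv (fun s => v s + 2 * s * deriv v s) (normSq x))
        - normSq x * (v (normSq x) + 2 * normSq x * deriv v (normSq x)) ^ 2) := by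
  have hb : ∀ s, 0 ≤ s → AnalyticAt ℝ (fun s => v s + 2 * s * deriv v s) s := fun s hs =>
    (R.analyticAt_right s hs).add ((analyticAt_const.mul analyticAt_id).mul
      (R.analyticAt_right s hs).deriv)
  have hpd : ∀ i, partialDeriv i (conformalFactor u v)
      = fun y => 2 * y i * (v (normSq y) + 2 * normSq y * deriv v (normSq y)) := fun i =>
    funext (R.partialDeriv_conformalFactor i)
  have hfd : ∀ (i : Fin 2) (y : Plane), HasFDerivAt
      (fun y : Plane => 2 * y i * (v (normSq y) + 2 * normSq y * deriv v (normSq y))) _ y :=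
    fun i y => ((hasFDerivAt_coord i y).const_mul 2).mul
      (HasDerivAt.comp_hasFDerivAt (h₂ := fun s => v s + 2 * s * deriv v s) y
        (hb _ (normSq_nonneg y)).differentiableAt.hasDerivAt (hasFDerivAt_normSq y))
  rw [gaussCurvature_conformalMatrix (fun x => (R.conformalFactor_pos hAe x).ne')
    (fun x => (R.analyticAt_conformalFactor x).differentiableAt)
    (fun i => by rw [hpd]; exact fun y => (hfd i y).differentiableAt), hpd, hpd,
    partialDeriv_eq_of_hasFDerivAt (hfd 0 x), partialDeriv_eq_of_hasFDerivAt (hfd 1 x)]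
  simp
  simp only [normSq]
  ring

/-- The rotation vector field on the plane. -/
def planeRotation (x : Plane) : Plane := !₂[-x 1, x 0]

theorem RadialData.killing (R : RadialData Ae A2 u v) (hAe : 0 < Ae) (x : Plane) (i j : Fin 2) :
    ∑ k, (planeRotation x k *
        partialDeriv k (fun y => conformalMatrix (conformalFactor u v) y i j) x
      + conformalMatrix (conformalFactor u v) x k j
        * partialDeriv i (fun y => planeRotation y k) x
      + conformalMatrix (conformalFactor u v) x i k
        * partialDeriv j (fun y => planeRotation y k) x) = 0 := by
  have h0 : ∀ i, partialDeriv i (fun y => planeRotation y 0) x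
      = -(EuclideanSpace.single i 1 : Plane) 1 := fun i =>
    partialDeriv_eq_of_hasFDerivAt (f := fun y => -y 1) (hasFDerivAt_coord 1 x).neg i
  have h1 : ∀ i, partialDeriv i (fun y => planeRotation y 1) x
      = (EuclideanSpace.single i 1 : Plane) 0 := fun i =>
    partialDeriv_eq_of_hasFDerivAt (f := fun y => y 0) (hasFDerivAt_coord 0 x) i
  simp only [Fin.sum_univ_two, h0, h1, partialDeriv_conformalMatrix
    (R.conformalFactor_pos hAe x).ne' (R.analyticAt_conformalFactor x).differentiableAt,
    R.partialDeriv_conformalFactor]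
  simp only [planeRotation, conformalMatrix]
  fin_cases i <;> fin_cases j <;> simp <;> ring

end Radial

/-! ### Integrals of the geodesic flow in a coordinate chart -/

/-- The Hamiltonian of the metric `|dx|² / ψ²`. -/
noncomputable def conformalHamiltonian (ψ : Plane → ℝ) (q : Plane × Plane) : ℝ :=
  1 / 2 * ψ q.1 ^ 2 * normSq q.2

/-- The bracket with the Hamiltonian is the derivative along the geodesic vector field, so it can be
computed by restricting `f` to a single line through the point. -/
lemma poissonBracket_conformalHamiltonian {ψ : Plane → ℝ} {f : Plane × Plane → ℝ} {x ξ : Plane}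
    (hψ : DifferentiableAt ℝ ψ x) :
    poissonBracket f (conformalHamiltonian ψ) (x, ξ) = fderiv ℝ f (x, ξ)
      (ψ x ^ 2 • ξ,
        -(ψ x * normSq ξ) • (!₂[partialDeriv 0 ψ x, partialDeriv 1 ψ x] : Plane)) := by
  have h1 : HasFDerivAt (fun q : Plane × Plane => ψ q.1)
      ((fderiv ℝ ψ x).comp (.fst ℝ Plane Plane)) (x, ξ) :=
    HasFDerivAt.comp (x, ξ) (f := fun q : Plane × Plane => q.1) hψ.hasFDerivAt hasFDerivAt_fst
  have h2 := HasFDerivAt.comp (x, ξ) (f := fun q : Plane × Plane => q.2) (hasFDerivAt_normSq ξ)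
    hasFDerivAt_snd
  have hk : HasFDerivAt (conformalHamiltonian ψ) _ (x, ξ) := ((h1.pow 2).const_mul (1 / 2)).mul h2
  have hw : ((ψ x ^ 2 • ξ,
        -(ψ x * normSq ξ) • (!₂[partialDeriv 0 ψ x, partialDeriv 1 ψ x] : Plane)) : Plane × Plane)
      = (ψ x ^ 2 * ξ 0) • (EuclideanSpace.single 0 1, 0)
        + (ψ x ^ 2 * ξ 1) • (EuclideanSpace.single 1 1, 0)
        + (-(ψ x * normSq ξ) * partialDeriv 0 ψ x) • (0, EuclideanSpace.single 0 1)
        + (-(ψ x * normSq ξ) * partialDeriv 1 ψ x) • (0, EuclideanSpace.single 1 1) := by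
    ext i <;> rcases (show i = 0 ∨ i = 1 by omega) with rfl | rfl <;> simp
  rw [hw, map_add, map_add, map_add, map_smul, map_smul, map_smul, map_smul, poissonBracket,
    Fin.sum_univ_two, hk.fderiv]
  simp [partialDeriv]
  ring

lemma hasDerivAt_coord_line (x w : Plane) (i : Fin 2) :
    HasDerivAt (fun τ : ℝ => (x + τ • w) i) (w i) 0 := by
  have h := ((hasDerivAt_id (0 : ℝ)).mul_const (w i)).const_add (x i)
  simpa using h

lemma fderiv_apply_eq_of_line {E : Type*} [NormedAddCommGroup E] [NormedSpace ℝ E] {f : E → ℝ}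
    {q w : E} {d : ℝ} (hf : DifferentiableAt ℝ f q)
    (h : HasDerivAt (fun τ : ℝ => f (q + τ • w)) d 0) : fderiv ℝ f q w = d :=
  (hf.hasFDerivAt.hasLineDerivAt w).unique h

/-- The angular momentum. -/
def angularMomentum (q : Plane × Plane) : ℝ := q.1 0 * q.2 1 - q.1 1 * q.2 0

lemma differentiable_angularMomentum : Differentiable ℝ angularMomentum := by
  unfold angularMomentum
  fun_prop

/-- The cubic integral at the point `(x₀, x₁)` with momenta `(ξ₀, ξ₁)`, where `U` and `V` are the
values of the radial functions `u` and `v`. -/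
noncomputable def cubicValue (Ae A2 C φ x₀ x₁ ξ₀ ξ₁ U V : ℝ) : ℝ :=
  C * (((ξ₀ ^ 2 + ξ₁ ^ 2) * (U + (x₀ ^ 2 + x₁ ^ 2) * V) ^ 2
      + 1 / 2 * (4 * U * V + A2) * (x₀ * ξ₁ - x₁ * ξ₀) ^ 2)
      * (U * (ξ₀ * Real.cos φ - ξ₁ * Real.sin φ)
        + V * ((x₀ * Real.cos φ - x₁ * Real.sin φ) * (x₀ * ξ₀ + x₁ * ξ₁)
          + (x₀ * Real.sin φ + x₁ * Real.cos φ) * (x₀ * ξ₁ - x₁ * ξ₀)))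
    + (Ae - V * (4 * U * V + A2)) * (x₀ * Real.sin φ + x₁ * Real.cos φ)
      * (x₀ * ξ₁ - x₁ * ξ₀) ^ 3)

/-- The cubic integral in the coordinates `(x, ξ)` on the cotangent bundle of the plane. -/
noncomputable def cubicIntegral (Ae A2 C φ : ℝ) (u v : ℝ → ℝ) (q : Plane × Plane) : ℝ :=
  cubicValue Ae A2 C φ (q.1 0) (q.1 1) (q.2 0) (q.2 1) (u (normSq q.1)) (v (normSq q.1))

section Integrals

variable {Ae A2 : ℝ} {u v : ℝ → ℝ}

lemma hasDerivAt_comp_normSq_line {b : ℝ → ℝ} {b' : ℝ} {x : Plane}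
    (hb : HasDerivAt b b' (normSq x)) (w : Plane) :
    HasDerivAt (fun τ : ℝ => b (normSq (x + τ • w))) (b' * (2 * x 0 * w 0 + 2 * x 1 * w 1)) 0 := by
  have h : HasDerivAt (fun τ : ℝ => normSq (x + τ • w)) _ 0 :=
    ((hasDerivAt_coord_line x w 0).pow 2).add ((hasDerivAt_coord_line x w 1).pow 2)
  have hb' : HasDerivAt b b' (normSq (x + (0 : ℝ) • w)) := by simpa using hb
  refine (HasDerivAt.comp (h := fun τ : ℝ => normSq (x + τ • w)) (0 : ℝ) hb' h).congr_deriv ?_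
  simp

lemma RadialData.differentiable_cubicIntegral (R : RadialData Ae A2 u v) (C φ : ℝ) :
    Differentiable ℝ (cubicIntegral Ae A2 C φ u v) := by
  have hu : Differentiable ℝ fun q : Plane × Plane => u (normSq q.1) := fun q =>
    (analyticAt_comp_normSq R.analyticAt_left q.1).differentiableAt.comp q differentiableAt_fst
  have hv : Differentiable ℝ fun q : Plane × Plane => v (normSq q.1) := fun q =>
    (analyticAt_comp_normSq R.analyticAt_right q.1).differentiableAt.comp q differentiableAt_fst
  have hx : ∀ i, Differentiable ℝ fun q : Plane × Plane => q.1 i := fun i => by fun_prop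
  have hξ : ∀ i, Differentiable ℝ fun q : Plane × Plane => q.2 i := fun i => by fun_prop
  have hb := ((hx 0).mul (hξ 1)).sub ((hx 1).mul (hξ 0))
  have hD := ((hu.const_mul 4).mul hv).add_const A2
  have hσ := ((hx 0).mul_const (Real.sin φ)).add ((hx 1).mul_const (Real.cos φ))
  have hc := ((hx 0).mul_const (Real.cos φ)).sub ((hx 1).mul_const (Real.sin φ))
  have hE := ((((hξ 0).pow 2).add ((hξ 1).pow 2)).mul
    ((hu.add ((((hx 0).pow 2).add ((hx 1).pow 2)).mul hv)).pow 2)).add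
      ((hD.const_mul (1 / 2)).mul (hb.pow 2))
  have hl := (hu.mul (((hξ 0).mul_const (Real.cos φ)).sub ((hξ 1).mul_const (Real.sin φ)))).add
    (hv.mul ((hc.mul (((hx 0).mul (hξ 0)).add ((hx 1).mul (hξ 1)))).add (hσ.mul hb)))
  exact ((hE.mul hl).add ((((hv.mul hD).const_sub Ae).mul hσ).mul (hb.pow 3))).const_mul C

/-- The derivative is written out in scalar form so that the bracket below becomes a polynomial
identity. -/
lemma hasDerivAt_cubicValue {Ae A2 C φ : ℝ} {x₀ x₁ ξ₀ ξ₁ U V : ℝ → ℝ} {x₀' x₁' ξ₀' ξ₁' U' V' : ℝ}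
    {τ : ℝ} (hx₀ : HasDerivAt x₀ x₀' τ) (hx₁ : HasDerivAt x₁ x₁' τ) (hξ₀ : HasDerivAt ξ₀ ξ₀' τ)
    (hξ₁ : HasDerivAt ξ₁ ξ₁' τ) (hU : HasDerivAt U U' τ) (hV : HasDerivAt V V' τ) :
    HasDerivAt (fun r => cubicValue Ae A2 C φ (x₀ r) (x₁ r) (ξ₀ r) (ξ₁ r) (U r) (V r))
      (C * (
        (2 * (ξ₀ τ * ξ₀' + ξ₁ τ * ξ₁') * (U τ + (x₀ τ ^ 2 + x₁ τ ^ 2) * V τ) ^ 2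
          + (ξ₀ τ ^ 2 + ξ₁ τ ^ 2) * (2 * (U τ + (x₀ τ ^ 2 + x₁ τ ^ 2) * V τ)
            * (U' + 2 * (x₀ τ * x₀' + x₁ τ * x₁') * V τ + (x₀ τ ^ 2 + x₁ τ ^ 2) * V'))
          + 1 / 2 * (4 * U' * V τ + 4 * U τ * V') * (x₀ τ * ξ₁ τ - x₁ τ * ξ₀ τ) ^ 2
          + (4 * U τ * V τ + A2) * (x₀ τ * ξ₁ τ - x₁ τ * ξ₀ τ)
            * (x₀' * ξ₁ τ + x₀ τ * ξ₁' - x₁' * ξ₀ τ - x₁ τ * ξ₀'))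
          * (U τ * (ξ₀ τ * Real.cos φ - ξ₁ τ * Real.sin φ)
            + V τ * ((x₀ τ * Real.cos φ - x₁ τ * Real.sin φ) * (x₀ τ * ξ₀ τ + x₁ τ * ξ₁ τ)
              + (x₀ τ * Real.sin φ + x₁ τ * Real.cos φ) * (x₀ τ * ξ₁ τ - x₁ τ * ξ₀ τ)))
        + ((ξ₀ τ ^ 2 + ξ₁ τ ^ 2) * (U τ + (x₀ τ ^ 2 + x₁ τ ^ 2) * V τ) ^ 2
          + 1 / 2 * (4 * U τ * V τ + A2) * (x₀ τ * ξ₁ τ - x₁ τ * ξ₀ τ) ^ 2)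
          * (U' * (ξ₀ τ * Real.cos φ - ξ₁ τ * Real.sin φ)
            + U τ * (ξ₀' * Real.cos φ - ξ₁' * Real.sin φ)
            + V' * ((x₀ τ * Real.cos φ - x₁ τ * Real.sin φ) * (x₀ τ * ξ₀ τ + x₁ τ * ξ₁ τ)
              + (x₀ τ * Real.sin φ + x₁ τ * Real.cos φ) * (x₀ τ * ξ₁ τ - x₁ τ * ξ₀ τ))
            + V τ * ((x₀' * Real.cos φ - x₁' * Real.sin φ) * (x₀ τ * ξ₀ τ + x₁ τ * ξ₁ τ)
              + (x₀ τ * Real.cos φ - x₁ τ * Real.sin φ)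
                * (x₀' * ξ₀ τ + x₀ τ * ξ₀' + x₁' * ξ₁ τ + x₁ τ * ξ₁')
              + (x₀' * Real.sin φ + x₁' * Real.cos φ) * (x₀ τ * ξ₁ τ - x₁ τ * ξ₀ τ)
              + (x₀ τ * Real.sin φ + x₁ τ * Real.cos φ)
                * (x₀' * ξ₁ τ + x₀ τ * ξ₁' - x₁' * ξ₀ τ - x₁ τ * ξ₀')))
        - (V' * (4 * U τ * V τ + A2) + V τ * (4 * U' * V τ + 4 * U τ * V'))
          * (x₀ τ * Real.sin φ + x₁ τ * Real.cos φ) * (x₀ τ * ξ₁ τ - x₁ τ * ξ₀ τ) ^ 3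
        + (Ae - V τ * (4 * U τ * V τ + A2)) * (x₀' * Real.sin φ + x₁' * Real.cos φ)
          * (x₀ τ * ξ₁ τ - x₁ τ * ξ₀ τ) ^ 3
        + (Ae - V τ * (4 * U τ * V τ + A2)) * (x₀ τ * Real.sin φ + x₁ τ * Real.cos φ)
          * (3 * (x₀ τ * ξ₁ τ - x₁ τ * ξ₀ τ) ^ 2
            * (x₀' * ξ₁ τ + x₀ τ * ξ₁' - x₁' * ξ₀ τ - x₁ τ * ξ₀')))) τ := by
  have hb := (hx₀.mul hξ₁).sub (hx₁.mul hξ₀)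
  have hD := ((hU.const_mul 4).mul hV).add_const A2
  have hσ := (hx₀.mul_const (Real.sin φ)).add (hx₁.mul_const (Real.cos φ))
  have hc := (hx₀.mul_const (Real.cos φ)).sub (hx₁.mul_const (Real.sin φ))
  have hE := (((hξ₀.pow 2).add (hξ₁.pow 2)).mul
    ((hU.add (((hx₀.pow 2).add (hx₁.pow 2)).mul hV)).pow 2)).add
      ((hD.const_mul (1 / 2)).mul (hb.pow 2))
  have hl := (hU.mul ((hξ₀.mul_const (Real.cos φ)).sub (hξ₁.mul_const (Real.sin φ)))).add
    (hV.mul ((hc.mul ((hx₀.mul hξ₀).add (hx₁.mul hξ₁))).add (hσ.mul hb)))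
  have h := (((hE.mul hl).add ((((hV.mul hD).const_sub Ae).mul hσ).mul (hb.pow 3))).const_mul C)
  have h' : HasDerivAt
    (fun r => cubicValue Ae A2 C φ (x₀ r) (x₁ r) (ξ₀ r) (ξ₁ r) (U r) (V r)) _ τ := h
  refine h'.congr_deriv ?_
  simp only [Pi.add_apply, Pi.mul_apply, Pi.sub_apply, Pi.pow_apply]
  ring

/-- After insertion of `u' = s v'`, the bracket is a polynomial in `x`, `ξ`, `u`, `v`, `v'`, `Ae`
and `A2`, which vanishes modulo the differential equation for `v`. The algebraic relation between
`u` and `v` is not needed. -/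
theorem RadialData.poissonBracket_cubicIntegral (R : RadialData Ae A2 u v) (C φ : ℝ)
    (x ξ : Plane) :
    poissonBracket (cubicIntegral Ae A2 C φ u v) (conformalHamiltonian (conformalFactor u v))
      (x, ξ) = 0 := by
  have hs := normSq_nonneg x
  rw [poissonBracket_conformalHamiltonian (R.analyticAt_conformalFactor x).differentiableAt]
  set w : Plane × Plane := (conformalFactor u v x ^ 2 • ξ,
    -(conformalFactor u v x * normSq ξ) • (!₂[partialDeriv 0 (conformalFactor u v) x,
      partialDeriv 1 (conformalFactor u v) x] : Plane)) with hw
  rw [fderiv_apply_eq_of_line (R.differentiable_cubicIntegral C φ (x, ξ))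
    (hasDerivAt_cubicValue (hasDerivAt_coord_line x w.1 0) (hasDerivAt_coord_line x w.1 1)
      (hasDerivAt_coord_line ξ w.2 0) (hasDerivAt_coord_line ξ w.2 1)
      (hasDerivAt_comp_normSq_line (R.hasDerivAt_left hs) w.1)
      (hasDerivAt_comp_normSq_line (R.hasDerivAt_right hs) w.1))]
  have hrel := R.deriv_right _ hs
  simp only [hw, zero_smul, add_zero, R.partialDeriv_conformalFactor, PiLp.smul_apply, smul_eq_mul,
    Matrix.cons_val_zero, Matrix.cons_val_one]
  generalize deriv v (normSq x) = V' at *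
  simp only [conformalFactor]
  generalize u (normSq x) = U at *
  generalize v (normSq x) = V at *
  simp only [normSq] at *
  generalize x 0 = x₀ at *
  generalize x 1 = x₁ at *
  generalize ξ 0 = ξ₀ at *
  generalize ξ 1 = ξ₁ at *
  -- That equation is linear in `Ae`, so eliminating `Ae` avoids any division.
  obtain rfl : Ae = V' * (2 * (x₀ ^ 2 + x₁ ^ 2) * (4 * U * V + A2)
    + 4 * (U + (x₀ ^ 2 + x₁ ^ 2) * V) ^ 2) + V * (4 * U * V + A2) := by linarith
  ring

theorem RadialData.poissonBracket_angularMomentum (R : RadialData Ae A2 u v) (x ξ : Plane) :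
    poissonBracket angularMomentum (conformalHamiltonian (conformalFactor u v)) (x, ξ) = 0 := by
  rw [poissonBracket_conformalHamiltonian (R.analyticAt_conformalFactor x).differentiableAt]
  set w : Plane × Plane := (conformalFactor u v x ^ 2 • ξ,
    -(conformalFactor u v x * normSq ξ) • (!₂[partialDeriv 0 (conformalFactor u v) x,
      partialDeriv 1 (conformalFactor u v) x] : Plane)) with hw
  have h : HasDerivAt (fun τ : ℝ => angularMomentum ((x, ξ) + τ • w)) _ 0 :=
    ((hasDerivAt_coord_line x w.1 0).mul (hasDerivAt_coord_line ξ w.2 1)).sub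
      ((hasDerivAt_coord_line x w.1 1).mul (hasDerivAt_coord_line ξ w.2 0))
  rw [fderiv_apply_eq_of_line (differentiable_angularMomentum _) h]
  simp [hw, R.partialDeriv_conformalFactor]
  ring

end Integrals

/-! ### The cubic integral: coefficients, polar form, inversion and independence -/

section Integrals

variable {Ae A2 : ℝ} {u v : ℝ → ℝ}

lemma analyticAt_coord (i : Fin 2) (x : Plane) : AnalyticAt ℝ (fun y : Plane => y i) x :=
  (EuclideanSpace.proj i : Plane →L[ℝ] ℝ).analyticAt x

/-- The integral has the form `C (q l + K b³)`, with `q` quadratic and `l` linear in `ξ` and `b` the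
angular momentum; `q₀, q₁, q₂` and `l₀, l₁` are the coefficients of `q` and `l`. -/
theorem RadialData.exists_cubicIntegral_coeff (R : RadialData Ae A2 u v) (C φ : ℝ) :
    ∃ a : Fin (3 + 1) → Plane → ℝ, (∀ i x, AnalyticAt ℝ (a i) x) ∧
      ∀ x ξ : Plane, cubicIntegral Ae A2 C φ u v (x, ξ) =
        ∑ i : Fin (3 + 1), a i x * ξ 0 ^ (3 - (i : ℕ)) * ξ 1 ^ (i : ℕ) := by
  let D : Plane → ℝ := fun x => 4 * u (normSq x) * v (normSq x) + A2
  let K : Plane → ℝ := fun x =>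
    (Ae - v (normSq x) * D x) * (x 0 * Real.sin φ + x 1 * Real.cos φ)
  let l₀ : Plane → ℝ := fun x => u (normSq x) * Real.cos φ + v (normSq x) *
    ((x 0 * Real.cos φ - x 1 * Real.sin φ) * x 0 - (x 0 * Real.sin φ + x 1 * Real.cos φ) * x 1)
  let l₁ : Plane → ℝ := fun x => -(u (normSq x) * Real.sin φ) + v (normSq x) *
    ((x 0 * Real.cos φ - x 1 * Real.sin φ) * x 1 + (x 0 * Real.sin φ + x 1 * Real.cos φ) * x 0)
  let q₀ : Plane → ℝ := fun x => conformalFactor u v x ^ 2 + 1 / 2 * D x * x 1 ^ 2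
  let q₁ : Plane → ℝ := fun x => -(D x * x 0 * x 1)
  let q₂ : Plane → ℝ := fun x => conformalFactor u v x ^ 2 + 1 / 2 * D x * x 0 ^ 2
  have hu := analyticAt_comp_normSq R.analyticAt_left
  have hv := analyticAt_comp_normSq R.analyticAt_right
  have h0 := analyticAt_coord 0
  have h1 := analyticAt_coord 1
  have hP := R.analyticAt_conformalFactor
  have hk : ∀ (c : ℝ) x, AnalyticAt ℝ (fun _ : Plane => c) x := fun c x => analyticAt_const
  have hD : ∀ x, AnalyticAt ℝ D x := fun x => (((hk _ x).mul (hu x)).mul (hv x)).add (hk _ x)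
  have hc : ∀ x, AnalyticAt ℝ (fun x : Plane => x 0 * Real.cos φ - x 1 * Real.sin φ) x :=
    fun x => ((h0 x).mul (hk _ x)).sub ((h1 x).mul (hk _ x))
  have hσ : ∀ x, AnalyticAt ℝ (fun x : Plane => x 0 * Real.sin φ + x 1 * Real.cos φ) x :=
    fun x => ((h0 x).mul (hk _ x)).add ((h1 x).mul (hk _ x))
  have hK : ∀ x, AnalyticAt ℝ K x := fun x =>
    ((hk _ x).sub ((hv x).mul (hD x))).mul (hσ x)
  have hl₀ : ∀ x, AnalyticAt ℝ l₀ x := fun x => ((hu x).mul (hk _ x)).add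
    ((hv x).mul (((hc x).mul (h0 x)).sub ((hσ x).mul (h1 x))))
  have hl₁ : ∀ x, AnalyticAt ℝ l₁ x := fun x => ((hu x).mul (hk _ x)).neg.add
    ((hv x).mul (((hc x).mul (h1 x)).add ((hσ x).mul (h0 x))))
  have hq₀ : ∀ x, AnalyticAt ℝ q₀ x := fun x =>
    ((hP x).pow 2).add (((hk _ x).mul (hD x)).mul ((h1 x).pow 2))
  have hq₁ : ∀ x, AnalyticAt ℝ q₁ x := fun x => (((hD x).mul (h0 x)).mul (h1 x)).neg
  have hq₂ : ∀ x, AnalyticAt ℝ q₂ x := fun x =>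
    ((hP x).pow 2).add (((hk _ x).mul (hD x)).mul ((h0 x).pow 2))
  refine ⟨![fun x => C * (q₀ x * l₀ x - K x * x 1 ^ 3),
    fun x => C * (q₀ x * l₁ x + q₁ x * l₀ x + 3 * K x * x 0 * x 1 ^ 2),
    fun x => C * (q₁ x * l₁ x + q₂ x * l₀ x - 3 * K x * x 0 ^ 2 * x 1),
    fun x => C * (q₂ x * l₁ x + K x * x 0 ^ 3)], fun i x => ?_, fun x ξ => ?_⟩
  · fin_cases i
    · exact (hk C x).mul (((hq₀ x).mul (hl₀ x)).sub ((hK x).mul ((h1 x).pow 3)))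
    · exact (hk C x).mul ((((hq₀ x).mul (hl₁ x)).add ((hq₁ x).mul (hl₀ x))).add
        ((((hk 3 x).mul (hK x)).mul (h0 x)).mul ((h1 x).pow 2)))
    · exact (hk C x).mul ((((hq₁ x).mul (hl₁ x)).add ((hq₂ x).mul (hl₀ x))).sub
        ((((hk 3 x).mul (hK x)).mul ((h0 x).pow 2)).mul (h1 x)))
    · exact (hk C x).mul (((hq₂ x).mul (hl₁ x)).add ((hK x).mul ((h0 x).pow 3)))
  · refine Eq.trans ?_ (Fin.sum_univ_four _).symm
    simp only [Matrix.cons_val_zero, Matrix.cons_val_one, Matrix.cons_val, Fin.coe_ofNat_eq_mod]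
    simp only [cubicIntegral, cubicValue, D, K, l₀, l₁, q₀, q₁, q₂, conformalFactor, normSq]
    norm_num
    ring

/-- Here `a` and `b` are the radial and angular components of the momentum, so `p_x = t a` and `p_y
= t b`. The last bracket is `h_xx = h + 4 t³ V'`; trading `V'` for `Ae - V (4UV + A2)` by `hrel` is
what removes the denominators. -/
lemma cubicValue_polar {C φ t y a b U V V' : ℝ} (ht : t ≠ 0)
    (hrel : V' * (2 * t ^ 2 * (4 * U * V + A2) + 4 * (U + t ^ 2 * V) ^ 2) =
      Ae - V * (4 * U * V + A2)) :
    cubicValue Ae A2 C φ (t * Real.cos y) (t * Real.sin y) (Real.cos y * a - Real.sin y * b)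
        (Real.sin y * a + Real.cos y * b) U V =
      C * Real.cos (y + φ) *
        (((U + t ^ 2 * V) / t) ^ 3 * (t * a) ^ 3
          + (1 / 2) * (3 * ((U + t ^ 2 * V) / t) ^ 2 - (t * V - U / t) ^ 2 + A2)
            * ((U + t ^ 2 * V) / t) * (t * a * (t * b) ^ 2))
      + C * Real.sin (y + φ) *
        ((t * V - U / t) * ((U + t ^ 2 * V) / t) ^ 2 * ((t * a) ^ 2 * (t * b))
          + (1 / 2) * (3 * ((U + t ^ 2 * V) / t) ^ 2 - (t * V - U / t) ^ 2 + A2)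
            * (t * V - U / t + 4 * t ^ 3 * V') * (t * b) ^ 3) := by
  have h := Real.cos_sq_add_sin_sq y
  have e1 : (t * Real.cos y) ^ 2 + (t * Real.sin y) ^ 2 = t ^ 2 := by
    linear_combination t ^ 2 * h
  have e2 : (Real.cos y * a - Real.sin y * b) ^ 2 + (Real.sin y * a + Real.cos y * b) ^ 2
      = a ^ 2 + b ^ 2 := by linear_combination (a ^ 2 + b ^ 2) * h
  have e3 : t * Real.cos y * (Real.sin y * a + Real.cos y * b)
      - t * Real.sin y * (Real.cos y * a - Real.sin y * b) = t * b := by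
    linear_combination t * b * h
  have e4 : t * Real.cos y * (Real.cos y * a - Real.sin y * b)
      + t * Real.sin y * (Real.sin y * a + Real.cos y * b) = t * a := by
    linear_combination t * a * h
  have e5 : (Real.cos y * a - Real.sin y * b) * Real.cos φ
      - (Real.sin y * a + Real.cos y * b) * Real.sin φ
      = a * Real.cos (y + φ) - b * Real.sin (y + φ) := by
    rw [Real.cos_add, Real.sin_add]; ring
  have e6 : t * Real.cos y * Real.cos φ - t * Real.sin y * Real.sin φ = t * Real.cos (y + φ) := by
    rw [Real.cos_add]; ring
  have e7 : t * Real.cos y * Real.sin φ + t * Real.sin y * Real.cos φ = t * Real.sin (y + φ) := by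
    rw [Real.sin_add]; ring
  rw [cubicValue, e1, e2, e3, e4, e5, e6, e7, ← hrel]
  field_simp
  ring

/-- Inversion fixes the angular momentum, flips the radial momentum and exchanges `U` with `V`. The
linear factor changes sign, and by `hrel` (step `e9`) so does the coefficient of the angular
momentum cubed, hence the `-C`. -/
lemma cubicValue_inversion {C φ y₀ y₁ η₀ η₁ U V : ℝ} (hs : y₀ ^ 2 + y₁ ^ 2 ≠ 0)
    (hrel : (V + (y₀ ^ 2 + y₁ ^ 2) * U) * (4 * V * U + A2) = Ae * (1 + (y₀ ^ 2 + y₁ ^ 2))) :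
    cubicValue Ae A2 C φ (y₀ / (y₀ ^ 2 + y₁ ^ 2)) (y₁ / (y₀ ^ 2 + y₁ ^ 2))
        ((y₀ ^ 2 + y₁ ^ 2) * η₀ - 2 * (y₀ * η₀ + y₁ * η₁) * y₀)
        ((y₀ ^ 2 + y₁ ^ 2) * η₁ - 2 * (y₀ * η₀ + y₁ * η₁) * y₁) U V =
      cubicValue Ae A2 (-C) φ y₀ y₁ η₀ η₁ V U := by
  have h1 : (4 * U * V + A2) = (4 * V * U + A2) := by ring
  have e1 : (y₀ / (y₀ ^ 2 + y₁ ^ 2)) ^ 2 + (y₁ / (y₀ ^ 2 + y₁ ^ 2)) ^ 2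
      = (y₀ ^ 2 + y₁ ^ 2)⁻¹ := by field_simp
  have e2 : ((y₀ ^ 2 + y₁ ^ 2) * η₀ - 2 * (y₀ * η₀ + y₁ * η₁) * y₀) ^ 2
      + ((y₀ ^ 2 + y₁ ^ 2) * η₁ - 2 * (y₀ * η₀ + y₁ * η₁) * y₁) ^ 2
      = (y₀ ^ 2 + y₁ ^ 2) ^ 2 * (η₀ ^ 2 + η₁ ^ 2) := by ring
  have e3 : y₀ / (y₀ ^ 2 + y₁ ^ 2) * ((y₀ ^ 2 + y₁ ^ 2) * η₁ - 2 * (y₀ * η₀ + y₁ * η₁) * y₁)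
      - y₁ / (y₀ ^ 2 + y₁ ^ 2) * ((y₀ ^ 2 + y₁ ^ 2) * η₀ - 2 * (y₀ * η₀ + y₁ * η₁) * y₀)
      = y₀ * η₁ - y₁ * η₀ := by field_simp; ring
  have e4 : y₀ / (y₀ ^ 2 + y₁ ^ 2) * ((y₀ ^ 2 + y₁ ^ 2) * η₀ - 2 * (y₀ * η₀ + y₁ * η₁) * y₀)
      + y₁ / (y₀ ^ 2 + y₁ ^ 2) * ((y₀ ^ 2 + y₁ ^ 2) * η₁ - 2 * (y₀ * η₀ + y₁ * η₁) * y₁)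
      = -(y₀ * η₀ + y₁ * η₁) := by field_simp; ring
  have e5 : ((y₀ ^ 2 + y₁ ^ 2) * η₀ - 2 * (y₀ * η₀ + y₁ * η₁) * y₀) * Real.cos φ
      - ((y₀ ^ 2 + y₁ ^ 2) * η₁ - 2 * (y₀ * η₀ + y₁ * η₁) * y₁) * Real.sin φ
      = -((y₀ * Real.cos φ - y₁ * Real.sin φ) * (y₀ * η₀ + y₁ * η₁)
          + (y₀ * Real.sin φ + y₁ * Real.cos φ) * (y₀ * η₁ - y₁ * η₀)) := by ring
  have e6 : (y₀ / (y₀ ^ 2 + y₁ ^ 2) * Real.cos φ - y₁ / (y₀ ^ 2 + y₁ ^ 2) * Real.sin φ)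
        * -(y₀ * η₀ + y₁ * η₁)
      + (y₀ / (y₀ ^ 2 + y₁ ^ 2) * Real.sin φ + y₁ / (y₀ ^ 2 + y₁ ^ 2) * Real.cos φ)
        * (y₀ * η₁ - y₁ * η₀)
      = -(η₀ * Real.cos φ - η₁ * Real.sin φ) := by field_simp; ring
  have e7 : y₀ / (y₀ ^ 2 + y₁ ^ 2) * Real.sin φ + y₁ / (y₀ ^ 2 + y₁ ^ 2) * Real.cos φ
      = (y₀ ^ 2 + y₁ ^ 2)⁻¹ * (y₀ * Real.sin φ + y₁ * Real.cos φ) := by field_simp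
  have e8 : (y₀ ^ 2 + y₁ ^ 2) ^ 2 * (η₀ ^ 2 + η₁ ^ 2) * (U + (y₀ ^ 2 + y₁ ^ 2)⁻¹ * V) ^ 2
      = (η₀ ^ 2 + η₁ ^ 2) * (V + (y₀ ^ 2 + y₁ ^ 2) * U) ^ 2 := by field_simp; ring
  have e9 : (Ae - V * (4 * V * U + A2)) * (y₀ ^ 2 + y₁ ^ 2)⁻¹ = -(Ae - U * (4 * V * U + A2)) := by
    field_simp
    linear_combination -hrel
  simp only [cubicValue]
  rw [h1, e3, e4, e6, e1, e2, e5, e7, e8, ← mul_assoc (Ae - V * (4 * V * U + A2)), e9]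
  ring

/-- At `x = 0` and a unit covector on which the linear factor of the cubic vanishes, the three
differentials separate: that of the angular momentum sees only positions, that of the cubic only
momenta orthogonal to `ξ`, and that of the Hamiltonian only momenta along `ξ`. -/
theorem RadialData.linearIndependent_fderiv (R : RadialData Ae A2 u v) (hAe : 0 < Ae) {C : ℝ}
    (hC : C ≠ 0) (φ : ℝ) :
    LinearIndependent ℝ
      ![fderiv ℝ angularMomentum ((0 : Plane), (!₂[Real.sin φ, Real.cos φ] : Plane)),
        fderiv ℝ (cubicIntegral Ae A2 C φ u v) ((0 : Plane), (!₂[Real.sin φ, Real.cos φ] : Plane)),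
        fderiv ℝ (conformalHamiltonian (conformalFactor u v))
          ((0 : Plane), (!₂[Real.sin φ, Real.cos φ] : Plane))] := by
  have h0 : normSq (0 : Plane) = 0 := by simp [normSq]
  have hs := normSq_nonneg 0
  set ξ : Plane := !₂[Real.sin φ, Real.cos φ] with hξ
  have hU : 0 < u 0 := by simpa using R.eigen_pos hAe le_rfl
  have hsc := Real.sin_sq_add_cos_sq φ
  have dL : ∀ w : Plane × Plane, fderiv ℝ angularMomentum ((0 : Plane), ξ) w
      = w.1 0 * Real.cos φ - w.1 1 * Real.sin φ := fun w => by
    have h : HasDerivAt (fun τ : ℝ => angularMomentum (((0 : Plane), ξ) + τ • w)) _ 0 :=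
      ((hasDerivAt_coord_line 0 w.1 0).mul (hasDerivAt_coord_line ξ w.2 1)).sub
        ((hasDerivAt_coord_line 0 w.1 1).mul (hasDerivAt_coord_line ξ w.2 0))
    rw [fderiv_apply_eq_of_line (differentiable_angularMomentum _) h]
    simp [hξ]
  have dF : ∀ w : Plane × Plane, fderiv ℝ (cubicIntegral Ae A2 C φ u v) ((0 : Plane), ξ) w
      = C * u 0 ^ 3 * (w.2 0 * Real.cos φ - w.2 1 * Real.sin φ) := fun w => by
    rw [fderiv_apply_eq_of_line (R.differentiable_cubicIntegral C φ (0, ξ))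
      (hasDerivAt_cubicValue (hasDerivAt_coord_line 0 w.1 0) (hasDerivAt_coord_line 0 w.1 1)
        (hasDerivAt_coord_line ξ w.2 0) (hasDerivAt_coord_line ξ w.2 1)
        (hasDerivAt_comp_normSq_line (R.hasDerivAt_left hs) w.1)
        (hasDerivAt_comp_normSq_line (R.hasDerivAt_right hs) w.1))]
    simp [hξ, h0]
    ring
  have dH : ∀ w : Plane × Plane,
      fderiv ℝ (conformalHamiltonian (conformalFactor u v)) ((0 : Plane), ξ) w
        = u 0 ^ 2 * (w.2 0 * Real.sin φ + w.2 1 * Real.cos φ) := fun w => by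
    have hd : Differentiable ℝ (conformalHamiltonian (conformalFactor u v)) := by
      intro q
      have h1 : DifferentiableAt ℝ (fun q : Plane × Plane => conformalFactor u v q.1) q :=
        (R.analyticAt_conformalFactor q.1).differentiableAt.comp q differentiableAt_fst
      have h2 : DifferentiableAt ℝ (fun q : Plane × Plane => normSq q.2) q :=
        (analyticAt_normSq q.2).differentiableAt.comp q differentiableAt_snd
      exact ((h1.pow 2).const_mul (1 / 2)).mul h2
    have h : HasDerivAt
        (fun τ : ℝ => conformalHamiltonian (conformalFactor u v) (((0 : Plane), ξ) + τ • w)) _ 0 :=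
      (((hasDerivAt_comp_normSq_line (b := fun r => u r + r * v r) (R.hasDerivAt_factor hs)
        w.1).pow 2).const_mul (1 / 2)).mul
        (hasDerivAt_comp_normSq_line (b := fun r => r) (hasDerivAt_id _) w.2)
    rw [fderiv_apply_eq_of_line (hd _) h]
    simp [hξ, h0]
    ring
  rw [Fintype.linearIndependent_iff]
  intro g hg
  have key : ∀ w : Plane × Plane, g 0 * (w.1 0 * Real.cos φ - w.1 1 * Real.sin φ)
      + g 1 * (C * u 0 ^ 3 * (w.2 0 * Real.cos φ - w.2 1 * Real.sin φ))
      + g 2 * (u 0 ^ 2 * (w.2 0 * Real.sin φ + w.2 1 * Real.cos φ)) = 0 := fun w => by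
    have := congrArg (fun l => l w) hg
    simpa [Fin.sum_univ_three, dL, dF, dH] using this
  -- Each of the three test vectors is annihilated by all but one of the differentials.
  have k0 := key (!₂[Real.cos φ, -Real.sin φ], 0)
  have k1 := key (0, !₂[Real.cos φ, -Real.sin φ])
  have k2 := key (0, ξ)
  simp [hξ, -mul_eq_zero] at k0 k1 k2
  have g0 : g 0 = 0 := by linear_combination k0 - g 0 * hsc
  have g1 : g 1 * (C * u 0 ^ 3) = 0 := by linear_combination k1 - g 1 * (C * u 0 ^ 3) * hsc
  have g2 : g 2 * u 0 ^ 2 = 0 := by linear_combination k2 - g 2 * u 0 ^ 2 * hsc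
  have g1' : g 1 = 0 := (mul_eq_zero.1 g1).resolve_right (by positivity)
  have g2' : g 2 = 0 := (mul_eq_zero.1 g2).resolve_right (by positivity)
  intro i
  fin_cases i <;> assumption

end Integrals

/-! ### Derivatives of the two charts of the sphere -/

/-- The derivative of the inversion `y ↦ y / |y|²`, and the identity at the origin. -/
noncomputable def inversionDeriv (y : Plane) : Plane →L[ℝ] Plane :=
  open Classical in
  if y = 0 then .id ℝ Plane else fderiv ℝ (EuclideanGeometry.inversion (0 : Plane) 1) y

lemma inversionDeriv_zero : inversionDeriv 0 = .id ℝ Plane := by simp [inversionDeriv]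

lemma hasFDerivAt_inversion_plane {y : Plane} (hy : y ≠ 0) :
    HasFDerivAt (EuclideanGeometry.inversion (0 : Plane) 1) (inversionDeriv y) y := by
  rw [inversionDeriv, if_neg hy]
  exact (EuclideanGeometry.hasFDerivAt_inversion hy).differentiableAt.hasFDerivAt

lemma normSq_ne_zero {y : Plane} (hy : y ≠ 0) : normSq y ≠ 0 := by
  rw [normSq_eq_norm]; simpa using hy

lemma inversion_apply (y : Plane) (i : Fin 2) :
    EuclideanGeometry.inversion (0 : Plane) 1 y i = y i / normSq y := by
  rw [normSq_eq_norm]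
  simp [EuclideanGeometry.inversion]
  ring

lemma inversionDeriv_apply {y : Plane} (hy : y ≠ 0) (w : Plane) (i : Fin 2) :
    inversionDeriv y w i
      = w i / normSq y - 2 * (y 0 * w 0 + y 1 * w 1) * y i / normSq y ^ 2 := by
  have hs := normSq_ne_zero hy
  have h1 := (EuclideanSpace.proj i : Plane →L[ℝ] ℝ).hasFDerivAt.comp y
    (hasFDerivAt_inversion_plane hy)
  have h2 := (hasFDerivAt_coord i y).mul
    ((hasDerivAt_inv hs).comp_hasFDerivAt y (hasFDerivAt_normSq y))
  have h3 := h1.unique (h2.congr_of_eventuallyEq (.of_forall fun z => by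
    simp [inversion_apply, div_eq_mul_inv]))
  have h4 := congrArg (fun l => l w) h3
  simp at h4
  rw [h4]
  field_simp
  ring

lemma chartInfty_symm_zero : chartInfty.symm (0 : Plane) = OnePoint.infty := by
  rw [chartInfty_symm_apply, invFun_zero]

lemma chartInfty_symm_of_ne {y : Plane} (hy : y ≠ 0) :
    chartInfty.symm y = ((EuclideanGeometry.inversion (0 : Plane) 1 y : Plane) : S2) := by
  rw [chartInfty_symm_apply, invFun_coe hy]

lemma extChartAt_coe (z : Plane) (p : S2) : extChartAt (𝓡 2) (z : S2) p = chartZero p := rfl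

lemma extChartAt_coe_symm (z y : Plane) : (extChartAt (𝓡 2) (z : S2)).symm y = (y : S2) :=
  chartZero_symm_apply y

lemma extChartAt_infty (p : S2) : extChartAt (𝓡 2) (OnePoint.infty : S2) p = chartInfty p := rfl

lemma extChartAt_infty_symm (y : Plane) :
    (extChartAt (𝓡 2) (OnePoint.infty : S2)).symm y = chartInfty.symm y := rfl

lemma extChartAt_plane (y w : Plane) : extChartAt (𝓡 2) y w = w := rfl

lemma extChartAt_plane_symm (y w : Plane) : (extChartAt (𝓡 2) y).symm w = w := rfl

lemma chartInfty_target : chartInfty.target = Set.univ := by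
  ext y
  simp only [Set.mem_univ, iff_true]
  have h : chartInfty.symm y ∈ chartInfty.source := by
    rw [chartInfty_source, Set.mem_preimage, chartInfty_symm_apply, invFun_invFun]
    exact ⟨y, rfl⟩
  have h' := chartInfty.map_source h
  have h'' : chartInfty (chartInfty.symm y) = y := by
    rw [chartInfty_symm_apply, chartInfty_apply, invFun_invFun, chartZero_coe]
  rwa [h''] at h'

lemma chartInfty_apply_symm (y : Plane) : chartInfty (chartInfty.symm y) = y :=
  chartInfty.right_inv (by rw [chartInfty_target]; trivial)

lemma chartInfty_coe {z : Plane} (hz : z ≠ 0) :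
    chartInfty (z : S2) = EuclideanGeometry.inversion (0 : Plane) 1 z := by
  rw [chartInfty_apply, invFun_coe hz, chartZero_coe]

lemma continuous_chartInfty_symm : Continuous chartInfty.symm := by
  rw [← continuousOn_univ, ← chartInfty_target]
  exact chartInfty.continuousOn_symm

lemma continuous_chartZero_symm : Continuous chartZero.symm := by
  rw [← continuousOn_univ, ← chartZero_target]
  exact chartZero.continuousOn_symm

lemma mfderiv_chartZero_symm (y : Plane) :
    mfderiv (𝓡 2) (𝓡 2) chartZero.symm y = (.id ℝ Plane : Plane →L[ℝ] Plane) := by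
  refine HasMFDerivAt.mfderiv ⟨continuous_chartZero_symm.continuousAt, ?_⟩
  have h : writtenInExtChartAt (𝓡 2) (𝓡 2) y chartZero.symm = id := by
    ext1 w
    simp only [writtenInExtChartAt, chartZero_symm_apply, Function.comp_apply, extChartAt_coe,
      extChartAt_plane_symm, chartZero_coe, id_eq]
  rw [h]
  exact hasFDerivWithinAt_id _ _

lemma mfderiv_chartZero (z : Plane) :
    mfderiv (𝓡 2) (𝓡 2) chartZero (z : S2) = (.id ℝ Plane : Plane →L[ℝ] Plane) := by
  refine HasMFDerivAt.mfderiv ⟨chartZero.continuousAt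
    (by rw [chartZero_source]; exact ⟨z, rfl⟩), ?_⟩
  have h : writtenInExtChartAt (𝓡 2) (𝓡 2) (z : S2) chartZero = id := by
    ext1 w
    simp only [writtenInExtChartAt, Function.comp_apply, extChartAt_coe_symm, chartZero_coe,
      extChartAt_plane, id_eq]
  rw [h]
  exact hasFDerivWithinAt_id _ _

/-- Tangent vectors are read in the preferred chart of the base point: `chartZero` away from `∞`,
which gives the derivative of the inversion, and `chartInfty` itself at `∞`, which gives the
identity for `y = 0`. -/
lemma mfderiv_chartInfty_symm (y : Plane) :
    mfderiv (𝓡 2) (𝓡 2) chartInfty.symm y = (inversionDeriv y : Plane →L[ℝ] Plane) := by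
  refine HasMFDerivAt.mfderiv ⟨continuous_chartInfty_symm.continuousAt, ?_⟩
  by_cases hy : y = 0
  · subst hy
    have h : writtenInExtChartAt (𝓡 2) (𝓡 2) (0 : Plane) chartInfty.symm = id := by
      ext1 w
      simp only [writtenInExtChartAt, chartInfty_symm_zero, Function.comp_apply, extChartAt_infty,
        extChartAt_plane_symm, chartInfty_apply_symm, id_eq]
    rw [h, inversionDeriv_zero]
    exact hasFDerivWithinAt_id _ _
  · have h : writtenInExtChartAt (𝓡 2) (𝓡 2) y chartInfty.symm =ᶠ[𝓝 y]
        EuclideanGeometry.inversion (0 : Plane) 1 := by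
      filter_upwards [isOpen_ne.mem_nhds hy] with w hw
      simp only [writtenInExtChartAt, chartInfty_symm_of_ne hy, Function.comp_apply,
        extChartAt_coe, extChartAt_plane_symm, chartInfty_symm_of_ne hw, chartZero_coe]
    exact ((hasFDerivAt_inversion_plane hy).congr_of_eventuallyEq h).hasFDerivWithinAt

lemma mfderiv_chartInfty_infty :
    mfderiv (𝓡 2) (𝓡 2) chartInfty (OnePoint.infty : S2) = (.id ℝ Plane : Plane →L[ℝ] Plane) := by
  refine HasMFDerivAt.mfderiv ⟨chartInfty.continuousAt
    (by rw [chartInfty_source]; exact ⟨0, rfl⟩), ?_⟩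
  have h : writtenInExtChartAt (𝓡 2) (𝓡 2) (OnePoint.infty : S2) chartInfty = id := by
    ext1 w
    simp only [writtenInExtChartAt, Function.comp_apply, extChartAt_infty_symm,
      chartInfty_apply_symm, extChartAt_plane, id_eq]
  rw [h]
  exact hasFDerivWithinAt_id _ _

lemma mfderiv_chartInfty_coe {z : Plane} (hz : z ≠ 0) :
    mfderiv (𝓡 2) (𝓡 2) chartInfty (z : S2) = (inversionDeriv z : Plane →L[ℝ] Plane) := by
  refine HasMFDerivAt.mfderiv ⟨chartInfty.continuousAt
    (by rw [chartInfty_source]; exact ⟨_, (invFun_coe hz).symm⟩), ?_⟩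
  have h : writtenInExtChartAt (𝓡 2) (𝓡 2) (z : S2) chartInfty =ᶠ[𝓝 z]
      EuclideanGeometry.inversion (0 : Plane) 1 := by
    filter_upwards [isOpen_ne.mem_nhds hz] with w hw
    simp only [writtenInExtChartAt, Function.comp_apply, extChartAt_coe_symm, chartInfty_coe hw,
      extChartAt_plane]
  have h' : extChartAt (𝓡 2) (z : S2) (z : S2) = z := chartZero_coe z
  rw [h']
  exact ((hasFDerivAt_inversion_plane hz).congr_of_eventuallyEq h).hasFDerivWithinAt

/-! ### The metric on the sphere -/

section ScaledInner

/-- The scalar multiples of a vector. -/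
noncomputable def scalarMultiple {F : Type*} [NormedAddCommGroup F] [NormedSpace ℝ F] (f : F)
    (c : ℝ) : F := c • f

lemma contDiff_scalarMultiple {F : Type*} [NormedAddCommGroup F] [NormedSpace ℝ F] (f : F)
    {n : WithTop ℕ∞} : ContDiff ℝ n (scalarMultiple f) :=
  contDiff_id.smul contDiff_const

variable (E : Type*) [NormedAddCommGroup E] [InnerProductSpace ℝ E]

/-- A multiple of the inner product, as a bilinear form. -/
noncomputable def scaledInner (c : ℝ) : E →L[ℝ] E →L[ℝ] ℝ :=
  scalarMultiple (innerSL ℝ : E →L[ℝ] E →L[ℝ] ℝ) c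

lemma contDiff_scaledInner {n : WithTop ℕ∞} : ContDiff ℝ n (scaledInner E) :=
  contDiff_scalarMultiple (F := E →L[ℝ] E →L[ℝ] ℝ) _

end ScaledInner

lemma inner_plane (w w' : Plane) : inner ℝ w w' = w 0 * w' 0 + w 1 * w' 1 := by
  rw [PiLp.inner_apply, Fin.sum_univ_two]
  simp [mul_comm]

lemma normSq_inversion (y : Plane) :
    normSq (EuclideanGeometry.inversion (0 : Plane) 1 y) = (normSq y)⁻¹ := by
  rw [normSq_eq_norm, normSq_eq_norm, norm_inversion, inv_pow]

lemma normSq_pos {y : Plane} (hy : y ≠ 0) : 0 < normSq y :=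
  lt_of_le_of_ne (normSq_nonneg y) (normSq_ne_zero hy).symm

/-- Inversion is conformal with factor `1 / |y|²`. -/
lemma inner_inversionDeriv {y : Plane} (hy : y ≠ 0) (w w' : Plane) :
    inner ℝ (inversionDeriv y w) (inversionDeriv y w') =
      inner ℝ w w' / normSq y ^ 2 := by
  have hs := normSq_ne_zero hy
  simp only [inner_plane, inversionDeriv_apply hy]
  field_simp
  simp only [normSq]
  ring

/-- The metric on the tangent spaces of the sphere, which are identified with the plane by means of
`chartInfty` at `∞` and of `chartZero` at all other points. -/
noncomputable def sphereInner (u v u' v' : ℝ → ℝ) : S2 → Plane →L[ℝ] Plane →L[ℝ] ℝ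
  | OnePoint.infty => scaledInner Plane (conformalFactor u' v' 0 ^ 2)⁻¹
  | OnePoint.some z => scaledInner Plane (conformalFactor u v z ^ 2)⁻¹

section Metric

variable {Ae A2 : ℝ} {u v u' v' : ℝ → ℝ}

lemma sphereInner_coe (z w w' : Plane) :
    sphereInner u v u' v' (z : S2) w w'
      = (conformalFactor u v z ^ 2)⁻¹ * inner ℝ w w' := rfl

lemma sphereInner_infty (w w' : Plane) :
    sphereInner u v u' v' OnePoint.infty w w'
      = (conformalFactor u' v' 0 ^ 2)⁻¹ * inner ℝ w w' := rfl

lemma SphereData.conformalFactor_inversion (S : SphereData Ae A2 u v u' v') {y : Plane}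
    (hy : y ≠ 0) : conformalFactor u v (EuclideanGeometry.inversion (0 : Plane) 1 y) * normSq y
      = conformalFactor u' v' y := by
  have hs := normSq_pos hy
  rw [conformalFactor, conformalFactor, normSq_inversion, S.inv_left _ hs, S.inv_right _ hs]
  field_simp
  ring

/-- The conformal factor of the inversion combines with `conformalFactor_inversion`, so the metric
near `∞` has the same shape, with `u'`, `v'` in place of `u`, `v`. -/
lemma SphereData.sphereInner_chartInfty (S : SphereData Ae A2 u v u' v') (y w w' : Plane) :
    sphereInner u v u' v' (chartInfty.symm y) (inversionDeriv y w) (inversionDeriv y w')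
      = (conformalFactor u' v' y ^ 2)⁻¹ * inner ℝ w w' := by
  by_cases hy : y = 0
  · subst hy
    rw [chartInfty_symm_zero, sphereInner_infty, inversionDeriv_zero]
    rfl
  · have hs := normSq_ne_zero hy
    rw [chartInfty_symm_of_ne hy, sphereInner_coe, inner_inversionDeriv hy,
      ← S.conformalFactor_inversion hy, mul_pow, mul_inv]
    ring

lemma contMDiffAt_scaledInner {ψ : Plane → ℝ} (hψ : ∀ y, AnalyticAt ℝ ψ y)
    (hψ0 : ∀ y, ψ y ≠ 0) (p₀ : S2) :
    ContMDiffAt (𝓡 2) 𝓘(ℝ, Plane →L[ℝ] Plane →L[ℝ] ℝ) ω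
      (fun p => scaledInner Plane (ψ (extChartAt (𝓡 2) p₀ p) ^ 2)⁻¹) p₀ := by
  have h1 : ContDiffAt ℝ ω (fun y => (ψ y ^ 2)⁻¹) (extChartAt (𝓡 2) p₀ p₀) :=
    (((hψ _).pow 2).inv (pow_ne_zero 2 (hψ0 _))).contDiffAt
  have h2 : ContDiffAt ℝ ω (fun y => scaledInner Plane (ψ y ^ 2)⁻¹) (extChartAt (𝓡 2) p₀ p₀) :=
    ContDiffAt.comp _ (contDiff_scaledInner Plane).contDiffAt h1
  exact h2.contMDiffAt.comp p₀ contMDiffAt_extChartAt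

lemma symm_trivializationAt_coe (z y w : Plane) :
    (trivializationAt Plane (TangentSpace (𝓡 2)) (z : S2)).symm (y : S2) w = w := by
  have hy : (y : S2) ∈ (chartAt Plane (z : S2)).source := by
    change (y : S2) ∈ chartZero.source; rw [chartZero_source]; exact ⟨y, rfl⟩
  have h := TangentBundle.symmL_trivializationAt (I := 𝓡 2) (M := S2) (x₀ := (z : S2))
    (x := (y : S2)) hy
  have h2 := congrArg (fun l : Plane →L[ℝ] Plane => l w) h
  refine Eq.trans (Bundle.Trivialization.symmL_apply (R := ℝ) _ hy w).symm (h2.trans ?_)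
  · rw [ModelWithCorners.range_eq_univ, mfderivWithin_univ]
    have h3 : extChartAt (𝓡 2) (z : S2) (y : S2) = y := chartZero_coe y
    rw [h3]
    exact congrArg (fun l : Plane →L[ℝ] Plane => l w) (mfderiv_chartZero_symm y)

lemma symm_trivializationAt_infty (y w : Plane) :
    (trivializationAt Plane (TangentSpace (𝓡 2)) (OnePoint.infty : S2)).symm
      (chartInfty.symm y) w = inversionDeriv y w := by
  have hy : chartInfty.symm y ∈ (chartAt Plane (OnePoint.infty : S2)).source :=
    chartInfty.map_target (by rw [chartInfty_target]; trivial)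
  have h := TangentBundle.symmL_trivializationAt (I := 𝓡 2) (M := S2)
    (x₀ := (OnePoint.infty : S2)) (x := chartInfty.symm y) hy
  have h2 := congrArg (fun l : Plane →L[ℝ] Plane => l w) h
  refine Eq.trans (Bundle.Trivialization.symmL_apply (R := ℝ) _ hy w).symm (h2.trans ?_)
  · rw [ModelWithCorners.range_eq_univ, mfderivWithin_univ]
    have h3 : extChartAt (𝓡 2) (OnePoint.infty : S2) (chartInfty.symm y) = y :=
      chartInfty_apply_symm y
    rw [h3]
    exact congrArg (fun l : Plane →L[ℝ] Plane => l w) (mfderiv_chartInfty_symm y)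

lemma eventually_mem_chart_source (p₀ : S2) :
    ∀ᶠ p in 𝓝 p₀, p ∈ (chartAt Plane p₀).source :=
  (chartAt Plane p₀).open_source.mem_nhds (mem_chart_source Plane p₀)

lemma SphereData.exists_sphereInner (S : SphereData Ae A2 u v u' v') (hAe : 0 < Ae) (p : S2) :
    ∃ c > 0, ∀ w w' : Plane, sphereInner u v u' v' p w w' = c * inner ℝ w w' := by
  induction p using OnePoint.rec with
  | infty =>
    have := S.infty.conformalFactor_pos hAe 0
    exact ⟨_, by positivity, sphereInner_infty⟩
  | coe z =>
    have := S.zero.conformalFactor_pos hAe z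
    exact ⟨_, by positivity, sphereInner_coe z⟩

lemma SphereData.sphereInner_comm (S : SphereData Ae A2 u v u' v') (hAe : 0 < Ae) (p : S2)
    (w w' : Plane) : sphereInner u v u' v' p w w' = sphereInner u v u' v' p w' w := by
  obtain ⟨c, -, hc⟩ := S.exists_sphereInner hAe p
  rw [hc, hc, real_inner_comm]

lemma SphereData.sphereInner_self_pos (S : SphereData Ae A2 u v u' v') (hAe : 0 < Ae) (p : S2)
    {w : Plane} (hw : w ≠ 0) : 0 < sphereInner u v u' v' p w w := by
  obtain ⟨c, hc0, hc⟩ := S.exists_sphereInner hAe p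
  rw [hc]
  exact mul_pos hc0 (real_inner_self_pos.2 hw)

lemma SphereData.isVonNBounded_sphereInner (S : SphereData Ae A2 u v u' v') (hAe : 0 < Ae)
    (p : S2) : Bornology.IsVonNBounded ℝ {w : Plane | sphereInner u v u' v' p w w < 1} := by
  obtain ⟨c, hc0, hc⟩ := S.exists_sphereInner hAe p
  refine (NormedSpace.isVonNBounded_ball ℝ Plane (√c)⁻¹).subset fun w hw => ?_
  replace hw : sphereInner u v u' v' p w w < 1 := hw
  have hs : 0 < √c := Real.sqrt_pos.2 hc0
  rw [hc, real_inner_self_eq_norm_sq, ← Real.sq_sqrt hc0.le, ← mul_pow,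
    sq_lt_one_iff₀ (by positivity)] at hw
  rwa [mem_ball_zero_iff, ← one_div, lt_div_iff₀' hs]

/-- The conformal metric on the sphere, as a form on the tangent spaces. -/
noncomputable def sphereForm (u v u' v' : ℝ → ℝ) (p : S2) :
    TangentSpace (𝓡 2) p →L[ℝ] TangentSpace (𝓡 2) p →L[ℝ] ℝ :=
  sphereInner u v u' v' p

/-- The conformal metric on the sphere. -/
noncomputable def SphereData.metric (S : SphereData Ae A2 u v u' v') (hAe : 0 < Ae) :
    AnalyticMetric S2 where
  inner := sphereForm u v u' v'
  symm p := S.sphereInner_comm hAe p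
  pos p _ hw := S.sphereInner_self_pos hAe p hw
  isVonNBounded p := S.isVonNBounded_sphereInner hAe p
  contMDiff := by
    intro p₀
    rw [Bundle.contMDiffAt_section]
    induction p₀ using OnePoint.rec with
    | infty =>
      -- In the trivialization at `∞` the form is a multiple of the Euclidean inner product, so its
      -- smoothness reduces to analyticity and positivity of the conformal factor.
      refine (contMDiffAt_scaledInner (fun y => S.infty.analyticAt_conformalFactor y)
        (fun y => (S.infty.conformalFactor_pos hAe y).ne') OnePoint.infty).congr_of_eventuallyEq ?_
      filter_upwards [eventually_mem_chart_source (OnePoint.infty : S2)] with p hp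
      obtain ⟨y, rfl⟩ : ∃ y, chartInfty.symm y = p := ⟨_, chartInfty.left_inv hp⟩
      have h3 : extChartAt (𝓡 2) (OnePoint.infty : S2) (chartInfty.symm y) = y :=
        chartInfty_apply_symm y
      rw [h3, hom_trivializationAt_apply]
      ext w w'
      refine (inCoordinates_apply_eq₂
        (hp : _ ∈ (trivializationAt Plane (TangentSpace (𝓡 2)) _).baseSet)
        (hp : _ ∈ (trivializationAt Plane (TangentSpace (𝓡 2)) _).baseSet)
        (by trivial)).trans ?_
      refine Eq.trans (b := sphereInner u v u' v' (chartInfty.symm y)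
        ((trivializationAt Plane (TangentSpace (𝓡 2)) (OnePoint.infty : S2)).symm
          (chartInfty.symm y) w)
        ((trivializationAt Plane (TangentSpace (𝓡 2)) (OnePoint.infty : S2)).symm
          (chartInfty.symm y) w')) ?_ ?_
      · exact congrArg (fun l : ℝ →ₗ[ℝ] ℝ => l _)
          (Bundle.Trivial.linearMapAt_trivialization ℝ S2 ℝ (chartInfty.symm y))
      · rw [symm_trivializationAt_infty, symm_trivializationAt_infty]
        exact S.sphereInner_chartInfty y w w'
    | coe z =>
      refine (contMDiffAt_scaledInner (fun y => S.zero.analyticAt_conformalFactor y)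
        (fun y => (S.zero.conformalFactor_pos hAe y).ne') (z : S2)).congr_of_eventuallyEq ?_
      filter_upwards [eventually_mem_chart_source (z : S2)] with p hp
      obtain ⟨y, rfl⟩ : ∃ y : Plane, (y : S2) = p :=
        ⟨_, (chartZero_symm_apply _).symm.trans (chartZero.left_inv hp)⟩
      have h3 : extChartAt (𝓡 2) (z : S2) (y : S2) = y := chartZero_coe y
      rw [h3, hom_trivializationAt_apply]
      ext w w'
      refine (inCoordinates_apply_eq₂
        (hp : _ ∈ (trivializationAt Plane (TangentSpace (𝓡 2)) _).baseSet)
        (hp : _ ∈ (trivializationAt Plane (TangentSpace (𝓡 2)) _).baseSet)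
        (by trivial)).trans ?_
      refine Eq.trans (b := sphereInner u v u' v' (y : S2)
        ((trivializationAt Plane (TangentSpace (𝓡 2)) (z : S2)).symm (y : S2) w)
        ((trivializationAt Plane (TangentSpace (𝓡 2)) (z : S2)).symm (y : S2) w')) ?_ ?_
      · exact congrArg (fun l : ℝ →ₗ[ℝ] ℝ => l _)
          (Bundle.Trivial.linearMapAt_trivialization ℝ S2 ℝ (y : S2))
      · rw [symm_trivializationAt_coe, symm_trivializationAt_coe]
        exact rfl

end Metric

/-! ### The metric in the two charts -/

section Charts

variable {Ae A2 : ℝ} {u v u' v' : ℝ → ℝ}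

lemma inner_single_single (i j : Fin 2) :
    inner ℝ (EuclideanSpace.single i 1 : Plane) (EuclideanSpace.single j 1)
      = (1 : Matrix (Fin 2) (Fin 2) ℝ) i j := by
  rw [EuclideanSpace.inner_single_left, Matrix.one_apply]
  simp

lemma sphereInner_congr {p : S2} {a b a' b' : Plane} (ha : a = a') (hb : b = b') :
    sphereInner u v u' v' p a b = sphereInner u v u' v' p a' b' := by rw [ha, hb]

lemma coordVector_chartZero (x : Plane) (i : Fin 2) :
    coordVector chartZero x i = (EuclideanSpace.single i 1 : Plane) :=
  congrArg (fun l : Plane →L[ℝ] Plane => l (EuclideanSpace.single i 1)) (mfderiv_chartZero_symm x)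

lemma coordVector_chartInfty (x : Plane) (i : Fin 2) :
    coordVector chartInfty x i = inversionDeriv x (EuclideanSpace.single i 1) :=
  congrArg (fun l : Plane →L[ℝ] Plane => l (EuclideanSpace.single i 1))
    (mfderiv_chartInfty_symm x)

lemma SphereData.metricMatrix_chartZero (S : SphereData Ae A2 u v u' v') (hAe : 0 < Ae)
    (x : Plane) : metricMatrix (S.metric hAe) chartZero x
      = conformalMatrix (conformalFactor u v) x := by
  ext i j
  refine Eq.trans (b := sphereInner u v u' v' (chartZero.symm x)
    (EuclideanSpace.single i 1 : Plane) (EuclideanSpace.single j 1)) ?_ ?_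
  · exact sphereInner_congr (p := chartZero.symm x) (coordVector_chartZero x i)
      (coordVector_chartZero x j)
  · rw [chartZero_symm_apply, sphereInner_coe, inner_single_single]
    rfl

lemma SphereData.metricMatrix_chartInfty (S : SphereData Ae A2 u v u' v') (hAe : 0 < Ae)
    (x : Plane) : metricMatrix (S.metric hAe) chartInfty x
      = conformalMatrix (conformalFactor u' v') x := by
  ext i j
  refine Eq.trans (b := sphereInner u v u' v' (chartInfty.symm x)
    (inversionDeriv x (EuclideanSpace.single i 1))
    (inversionDeriv x (EuclideanSpace.single j 1))) ?_ ?_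
  · exact sphereInner_congr (coordVector_chartInfty x i) (coordVector_chartInfty x j)
  · rw [S.sphereInner_chartInfty, inner_single_single]
    rfl

lemma localHamiltonian_eq {G : AnalyticMetric S2} {e : OpenPartialHomeomorph S2 Plane}
    {ψ : Plane → ℝ} (hψ : ∀ x, ψ x ≠ 0) (h : ∀ x, metricMatrix G e x = conformalMatrix ψ x) :
    localHamiltonian G e = conformalHamiltonian ψ := by
  ext q
  rw [localHamiltonian, h, conformalMatrix_inv (hψ _), conformalHamiltonian, normSq]
  simp [Fin.sum_univ_two]
  ring

lemma SphereData.localHamiltonian_chartZero (S : SphereData Ae A2 u v u' v') (hAe : 0 < Ae) :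
    localHamiltonian (S.metric hAe) chartZero = conformalHamiltonian (conformalFactor u v) :=
  localHamiltonian_eq (fun x => (S.zero.conformalFactor_pos hAe x).ne')
    (S.metricMatrix_chartZero hAe)

lemma SphereData.localHamiltonian_chartInfty (S : SphereData Ae A2 u v u' v') (hAe : 0 < Ae) :
    localHamiltonian (S.metric hAe) chartInfty = conformalHamiltonian (conformalFactor u' v') :=
  localHamiltonian_eq (fun x => (S.infty.conformalFactor_pos hAe x).ne')
    (S.metricMatrix_chartInfty hAe)

lemma forall_mem_atlas {P : OpenPartialHomeomorph S2 Plane → Prop} (h0 : P chartZero)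
    (h1 : P chartInfty) : ∀ e ∈ atlas Plane S2, P e := by
  intro e he
  have he' : e = chartZero ∨ e = chartInfty := he
  rcases he' with rfl | rfl
  exacts [h0, h1]

lemma chartZero_mem_atlas : chartZero ∈ atlas Plane S2 := Or.inl rfl

lemma chartInfty_mem_atlas : chartInfty ∈ atlas Plane S2 := Or.inr rfl

/-! ### The curvature of the metric -/

lemma RadialData.gaussCurvature_zero (R : RadialData Ae A2 u v) (hAe : 0 < Ae) :
    gaussCurvature (conformalMatrix (conformalFactor u v)) 0 = 4 * (u 0 * v 0) := by
  rw [R.gaussCurvature_eq hAe]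
  simp [conformalFactor, normSq]

lemma RadialData.gaussCurvature_const {a : ℝ} (R : RadialData Ae A2 (fun _ => a) (fun _ => a))
    (hAe : 0 < Ae) (x : Plane) :
    gaussCurvature (conformalMatrix (conformalFactor (fun _ => a) (fun _ => a))) x
      = 4 * a ^ 2 := by
  rw [R.gaussCurvature_eq hAe]
  simp [conformalFactor]
  ring

/-- The centres of the two charts suffice: there the curvature is `4 u 0 v 0` and `4 u' 0 v' 0`. -/
lemma SphereData.not_hasConstantCurvature (S : SphereData Ae A2 u v u' v') (hAe : 0 < Ae)
    (h : u 0 * v 0 ≠ u' 0 * v' 0) : ¬ HasConstantCurvature (S.metric hAe) := by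
  rintro ⟨κ, hκ⟩
  have h0 := hκ _ chartZero_mem_atlas 0 (by rw [chartZero_target]; trivial)
  have h1 := hκ _ chartInfty_mem_atlas 0 (by rw [chartInfty_target]; trivial)
  rw [funext (S.metricMatrix_chartZero hAe), S.zero.gaussCurvature_zero hAe] at h0
  rw [funext (S.metricMatrix_chartInfty hAe), S.infty.gaussCurvature_zero hAe] at h1
  exact h (by linarith)

lemma SphereData.hasConstantCurvature {a : ℝ}
    (S : SphereData Ae A2 (fun _ => a) (fun _ => a) (fun _ => a) (fun _ => a)) (hAe : 0 < Ae) :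
    HasConstantCurvature (S.metric hAe) := by
  refine ⟨4 * a ^ 2, forall_mem_atlas (fun x _ => ?_) fun x _ => ?_⟩
  · rw [funext (S.metricMatrix_chartZero hAe), S.zero.gaussCurvature_const hAe]
  · rw [funext (S.metricMatrix_chartInfty hAe), S.zero.gaussCurvature_const hAe]

/-! ### The rotation field -/

/-- The field of infinitesimal rotations, in terms of the plane. -/
noncomputable def rotationVector : S2 → Plane
  | OnePoint.infty => 0
  | OnePoint.some z => planeRotation z

/-- The field of infinitesimal rotations of the sphere. -/
noncomputable def rotationField (p : S2) : TangentSpace (𝓡 2) p := rotationVector p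

lemma rotationVector_coe (z : Plane) : rotationVector (z : S2) = planeRotation z := rfl

lemma rotationVector_infty : rotationVector OnePoint.infty = 0 := rfl

lemma planeRotation_zero : planeRotation 0 = 0 := by
  ext i
  rcases (show i = 0 ∨ i = 1 by omega) with rfl | rfl <;> simp [planeRotation]

lemma inversionDeriv_planeRotation {y : Plane} (hy : y ≠ 0) :
    inversionDeriv (EuclideanGeometry.inversion (0 : Plane) 1 y)
      (planeRotation (EuclideanGeometry.inversion (0 : Plane) 1 y)) = planeRotation y := by
  have hs := normSq_ne_zero hy
  ext i
  rw [inversionDeriv_apply (inversion_ne_zero hy), normSq_inversion]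
  rcases (show i = 0 ∨ i = 1 by omega) with rfl | rfl
  · simp [planeRotation, inversion_apply]
    field_simp
    ring
  · simp [planeRotation, inversion_apply]
    field_simp
    ring

lemma mfderiv_chartZero_apply {p : S2} {z : Plane} (hp : p = z) (w : Plane) :
    (mfderiv (𝓡 2) (𝓡 2) chartZero p : Plane →L[ℝ] Plane) w = w := by
  subst hp
  exact congrArg (fun l : Plane →L[ℝ] Plane => l w) (mfderiv_chartZero z)

lemma mfderiv_chartInfty_apply {p : S2} {z : Plane} (hz : z ≠ 0) (hp : p = z) (w : Plane) :
    (mfderiv (𝓡 2) (𝓡 2) chartInfty p : Plane →L[ℝ] Plane) w = inversionDeriv z w := by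
  subst hp
  exact congrArg (fun l : Plane →L[ℝ] Plane => l w) (mfderiv_chartInfty_coe hz)

lemma mfderiv_chartInfty_apply_infty {p : S2} (hp : p = OnePoint.infty) (w : Plane) :
    (mfderiv (𝓡 2) (𝓡 2) chartInfty p : Plane →L[ℝ] Plane) w = w := by
  subst hp
  exact congrArg (fun l : Plane →L[ℝ] Plane => l w) mfderiv_chartInfty_infty

lemma fieldCoord_rotationField_chartZero (x : Plane) :
    fieldCoord rotationField chartZero x = planeRotation x := by
  refine (mfderiv_chartZero_apply (chartZero_symm_apply x) _).trans ?_
  change rotationVector (chartZero.symm x) = _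
  rw [chartZero_symm_apply, rotationVector_coe]

lemma fieldCoord_rotationField_chartInfty (x : Plane) :
    fieldCoord rotationField chartInfty x = planeRotation x := by
  by_cases hx : x = 0
  · subst hx
    refine (mfderiv_chartInfty_apply_infty chartInfty_symm_zero _).trans ?_
    change rotationVector (chartInfty.symm 0) = _
    rw [chartInfty_symm_zero, rotationVector_infty, planeRotation_zero]
  · refine (mfderiv_chartInfty_apply (inversion_ne_zero hx) (chartInfty_symm_of_ne hx) _).trans ?_
    refine Eq.trans (congrArg _ ?_) (inversionDeriv_planeRotation hx)
    change rotationVector (chartInfty.symm x) = _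
    rw [chartInfty_symm_of_ne hx, rotationVector_coe]

lemma SphereData.isKilling_rotationField (S : SphereData Ae A2 u v u' v') (hAe : 0 < Ae) :
    IsKilling (S.metric hAe) rotationField := by
  refine forall_mem_atlas (fun x _ i j => ?_) fun x _ i j => ?_
  · simp only [fieldCoord_rotationField_chartZero, S.metricMatrix_chartZero hAe]
    exact S.zero.killing hAe x i j
  · simp only [fieldCoord_rotationField_chartInfty, S.metricMatrix_chartInfty hAe]
    exact S.infty.killing hAe x i j

lemma localExpr_linearMomentum (V : (p : S2) → TangentSpace (𝓡 2) p)
    (e : OpenPartialHomeomorph S2 Plane) (q : Plane × Plane) :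
    localExpr (linearMomentum V) e q = inner ℝ q.2 (fieldCoord V e q.1) := rfl

lemma inner_planeRotation (q : Plane × Plane) :
    inner ℝ q.2 (planeRotation q.1) = angularMomentum q := by
  rw [inner_plane, angularMomentum]
  simp [planeRotation]
  ring

lemma localExpr_rotation_chartZero :
    localExpr (linearMomentum rotationField) chartZero = angularMomentum := by
  ext q
  rw [localExpr_linearMomentum, fieldCoord_rotationField_chartZero, inner_planeRotation]

lemma localExpr_rotation_chartInfty :
    localExpr (linearMomentum rotationField) chartInfty = angularMomentum := by
  ext q
  rw [localExpr_linearMomentum, fieldCoord_rotationField_chartInfty, inner_planeRotation]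

lemma SphereData.isGeodesicIntegral_rotation (S : SphereData Ae A2 u v u' v') (hAe : 0 < Ae) :
    IsGeodesicIntegral (S.metric hAe) (linearMomentum rotationField) := by
  refine forall_mem_atlas (fun x _ ξ => ?_) fun x _ ξ => ?_
  · rw [localExpr_rotation_chartZero, S.localHamiltonian_chartZero]
    exact S.zero.poissonBracket_angularMomentum x ξ
  · rw [localExpr_rotation_chartInfty, S.localHamiltonian_chartInfty]
    exact S.infty.poissonBracket_angularMomentum x ξ

lemma isAnalyticPolynomial_rotation : IsAnalyticPolynomial 1 (linearMomentum rotationField) := by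
  have h : ∃ a : Fin (1 + 1) → Plane → ℝ, (∀ i x, AnalyticAt ℝ (a i) x) ∧ ∀ x ξ : Plane,
      angularMomentum (x, ξ) = ∑ i : Fin (1 + 1), a i x * ξ 0 ^ (1 - (i : ℕ)) * ξ 1 ^ (i : ℕ) := by
    refine ⟨![fun x => -x 1, fun x => x 0], Fin.forall_fin_two.2
      ⟨fun x => (analyticAt_coord 1 x).neg, fun x => analyticAt_coord 0 x⟩, fun x ξ => ?_⟩
    simp [Fin.sum_univ_two, angularMomentum]
    ring
  obtain ⟨a, ha, hL⟩ := h
  refine forall_mem_atlas ⟨a, fun i x _ => ha i x, fun x _ ξ => ?_⟩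
    ⟨a, fun i x _ => ha i x, fun x _ ξ => ?_⟩
  · rw [localExpr_rotation_chartZero, hL]
  · rw [localExpr_rotation_chartInfty, hL]

lemma analyticAt_planeRotation (x : Plane) : AnalyticAt ℝ planeRotation x := by
  have h : ContDiff ℝ ω planeRotation := by
    unfold planeRotation
    refine contDiff_euclidean.2 fun i => ?_
    rcases (show i = 0 ∨ i = 1 by omega) with rfl | rfl <;> simp <;> fun_prop
  exact h.contDiffAt.analyticAt

lemma trivializationAt_rotationField {p₀ p : S2} (hp : p ∈ (chartAt Plane p₀).source) :
    (trivializationAt Plane (TangentSpace (𝓡 2)) p₀ ⟨p, rotationField p⟩).2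
      = planeRotation (extChartAt (𝓡 2) p₀ p) := by
  have h := TangentBundle.continuousLinearMapAt_trivializationAt (I := 𝓡 2) (M := S2) hp
  have h2 := congrArg (fun l : Plane →L[ℝ] Plane => l (rotationVector p)) h
  refine (Bundle.Trivialization.continuousLinearMapAt_apply_of_mem (R := ℝ)
    (trivializationAt Plane (TangentSpace (𝓡 2)) p₀) hp (rotationField p)).symm.trans
    (h2.trans ?_)
  induction p₀ using OnePoint.rec with
  | infty =>
    obtain ⟨y, rfl⟩ : ∃ y, chartInfty.symm y = p := ⟨_, chartInfty.left_inv hp⟩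
    have h3 : extChartAt (𝓡 2) (OnePoint.infty : S2) (chartInfty.symm y) = y :=
      chartInfty_apply_symm y
    rw [h3]
    exact fieldCoord_rotationField_chartInfty y
  | coe z =>
    obtain ⟨y, rfl⟩ : ∃ y, chartZero.symm y = p := ⟨_, chartZero.left_inv hp⟩
    have h3 : extChartAt (𝓡 2) (z : S2) (chartZero.symm y) = y :=
      chartZero.right_inv (by rw [chartZero_target]; trivial)
    rw [h3]
    exact fieldCoord_rotationField_chartZero y

lemma contMDiff_rotationField : ContMDiff (𝓡 2) (𝓡 2).tangent ω
    (fun p => (⟨p, rotationField p⟩ : TangentBundle (𝓡 2) S2)) := by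
  intro p₀
  rw [Bundle.contMDiffAt_section]
  have h : ContMDiffAt (𝓡 2) (𝓡 2) ω (fun p => planeRotation (extChartAt (𝓡 2) p₀ p)) p₀ :=
    (analyticAt_planeRotation _).contDiffAt.contMDiffAt.comp p₀ contMDiffAt_extChartAt
  refine h.congr_of_eventuallyEq ?_
  filter_upwards [eventually_mem_chart_source p₀] with p hp
  exact trivializationAt_rotationField hp

end Charts

/-! ### Polar coordinates -/

/-- The point of the plane with polar coordinates `(t, φ)`. -/
noncomputable def polarMap (r : ℝ × ℝ) : Plane := !₂[r.1 * Real.cos r.2, r.1 * Real.sin r.2]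

/-- The derivative of polar coordinates. -/
noncomputable def polarDeriv (r w : ℝ × ℝ) : Plane :=
  !₂[w.1 * Real.cos r.2 - r.1 * w.2 * Real.sin r.2, w.1 * Real.sin r.2 + r.1 * w.2 * Real.cos r.2]

lemma exists_hasFDerivAt_polarMap (r : ℝ × ℝ) :
    ∃ L : ℝ × ℝ →L[ℝ] Plane, HasFDerivAt polarMap L r ∧ ∀ w, L w = polarDeriv r w := by
  have hc := (Real.hasDerivAt_cos r.2).comp_hasFDerivAt r (hasFDerivAt_snd (𝕜 := ℝ) (p := r))
  have hs := (Real.hasDerivAt_sin r.2).comp_hasFDerivAt r (hasFDerivAt_snd (𝕜 := ℝ) (p := r))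
  have ht := hasFDerivAt_fst (𝕜 := ℝ) (p := r)
  have h := ((ht.mul hc).smul_const (EuclideanSpace.single 0 1 : Plane)).add
    ((ht.mul hs).smul_const (EuclideanSpace.single 1 1 : Plane))
  refine ⟨_, h.congr_of_eventuallyEq (.of_forall fun z => ?_), fun w => ?_⟩
  · ext i
    rcases (show i = 0 ∨ i = 1 by omega) with rfl | rfl <;> simp [polarMap]
  · ext i
    rcases (show i = 0 ∨ i = 1 by omega) with rfl | rfl <;> simp [polarDeriv] <;> ring

/-- `polarPoint` avoids `∞`, so its derivative is read in `chartZero`, where it is the ordinary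
Jacobian of polar coordinates. -/
lemma polarVector_eq (r w : ℝ × ℝ) : polarVector r w = polarDeriv r w := by
  obtain ⟨L, hL, hLw⟩ := exists_hasFDerivAt_polarMap r
  have h : HasMFDerivAt 𝓘(ℝ, ℝ × ℝ) (𝓡 2) polarPoint r L := by
    refine ⟨OnePoint.continuous_coe.continuousAt.comp hL.continuousAt, ?_⟩
    have h : writtenInExtChartAt 𝓘(ℝ, ℝ × ℝ) (𝓡 2) r polarPoint = polarMap := by
      ext1 w
      exact chartZero_coe (polarMap w)
    rw [h]
    exact hL.hasFDerivWithinAt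
  rw [← hLw]
  exact congrArg (fun l : ℝ × ℝ →L[ℝ] Plane => l w) h.mfderiv

lemma normSq_polarMap (t φ : ℝ) : normSq (polarMap (t, φ)) = t ^ 2 := by
  simp [normSq, polarMap]
  linear_combination t ^ 2 * Real.sin_sq_add_cos_sq φ

section Polar

variable {Ae A2 : ℝ} {u v u' v' : ℝ → ℝ}

lemma SphereData.extendsPolarMetric (S : SphereData Ae A2 u v u' v') (hAe : 0 < Ae) :
    ExtendsPolarMetric (radialSolution u v) (S.metric hAe) := by
  intro t φ ht w w'
  refine Eq.trans (b := sphereInner u v u' v' (polarMap (t, φ) : S2) (polarDeriv (t, φ) w)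
    (polarDeriv (t, φ) w')) ?_ ?_
  · exact sphereInner_congr (p := (polarMap (t, φ) : S2)) (polarVector_eq _ _) (polarVector_eq _ _)
  · have h := S.zero.mul_deriv_solution ht
    have hne := S.zero.conformalFactor_pos hAe (polarMap (t, φ))
    have hψ : conformalFactor u v (polarMap (t, φ)) = t ^ 2 * deriv (radialSolution u v) t := by
      rw [conformalFactor, normSq_polarMap]
      field_simp at h
      linarith
    have hi : inner ℝ (polarDeriv (t, φ) w) (polarDeriv (t, φ) w')
        = w.1 * w'.1 + t ^ 2 * (w.2 * w'.2) := by
      rw [inner_plane]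
      simp [polarDeriv]
      linear_combination (w.1 * w'.1 + t ^ 2 * (w.2 * w'.2)) * Real.sin_sq_add_cos_sq φ
    rw [sphereInner_coe, hi, hψ, mul_pow, ← pow_mul, div_eq_inv_mul]

lemma extendsRotation_rotationField : ExtendsRotation rotationField := by
  intro t φ _
  rw [polarVector_eq]
  change planeRotation (polarMap (t, φ)) = _
  ext i
  rcases (show i = 0 ∨ i = 1 by omega) with rfl | rfl <;>
    simp [planeRotation, polarMap, polarDeriv]

/-! ### The cubic integral on the sphere -/

/-- The components of a covector of the plane. -/
noncomputable def covectorCoord (α : Plane →L[ℝ] ℝ) : Plane :=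
  !₂[α (EuclideanSpace.single 0 1), α (EuclideanSpace.single 1 1)]

lemma covectorCoord_apply (α : Plane →L[ℝ] ℝ) (i : Fin 2) :
    covectorCoord α i = α (EuclideanSpace.single i 1) := by
  rcases (show i = 0 ∨ i = 1 by omega) with rfl | rfl <;> rfl

lemma apply_eq_covectorCoord (α : Plane →L[ℝ] ℝ) (w : Plane) :
    α w = w 0 * covectorCoord α 0 + w 1 * covectorCoord α 1 := by
  have h : w = w 0 • EuclideanSpace.single 0 1 + w 1 • EuclideanSpace.single 1 1 := by
    ext i
    rcases (show i = 0 ∨ i = 1 by omega) with rfl | rfl <;> simp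
  conv_lhs => rw [h, map_add, map_smul, map_smul]
  rw [covectorCoord_apply, covectorCoord_apply, smul_eq_mul, smul_eq_mul]

/-- The cubic integral on covectors of the sphere, which are identified with those of the plane. -/
noncomputable def cubicPhaseAux (Ae A2 C φ : ℝ) (u v u' v' : ℝ → ℝ) :
    S2 → (Plane →L[ℝ] ℝ) → ℝ
  | OnePoint.infty, α => cubicIntegral Ae A2 (-C) φ u' v' (0, covectorCoord α)
  | OnePoint.some z, α => cubicIntegral Ae A2 C φ u v (z, covectorCoord α)

lemma cubicPhaseAux_infty (C φ : ℝ) (α : Plane →L[ℝ] ℝ) :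
    cubicPhaseAux Ae A2 C φ u v u' v' OnePoint.infty α
      = cubicIntegral Ae A2 (-C) φ u' v' (0, covectorCoord α) := rfl

lemma cubicPhaseAux_coe (C φ : ℝ) (z : Plane) (α : Plane →L[ℝ] ℝ) :
    cubicPhaseAux Ae A2 C φ u v u' v' (z : S2) α
      = cubicIntegral Ae A2 C φ u v (z, covectorCoord α) := rfl

/-- The cubic integral on the cotangent bundle of the sphere. -/
noncomputable def cubicPhase (Ae A2 C φ : ℝ) (u v u' v' : ℝ → ℝ) : PhaseFunction S2 :=
  fun p α => cubicPhaseAux Ae A2 C φ u v u' v' p α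

lemma inner_single (ξ : Plane) (i : Fin 2) :
    inner ℝ ξ (EuclideanSpace.single i 1 : Plane) = ξ i := by
  rw [inner_plane]
  rcases (show i = 0 ∨ i = 1 by omega) with rfl | rfl <;> simp

/-- The coordinate covector of a chart, with the tangent space identified with the plane. -/
noncomputable def planeCovector (e : OpenPartialHomeomorph S2 Plane) (x ξ : Plane) :
    Plane →L[ℝ] ℝ := covector e x ξ

lemma planeCovector_apply (e : OpenPartialHomeomorph S2 Plane) (x ξ w : Plane) :
    planeCovector e x ξ w
      = inner ℝ ξ ((mfderiv (𝓡 2) (𝓡 2) e (e.symm x) : Plane →L[ℝ] Plane) w) := rfl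

lemma localExpr_cubicPhase (C φ : ℝ) (e : OpenPartialHomeomorph S2 Plane) (q : Plane × Plane) :
    localExpr (cubicPhase Ae A2 C φ u v u' v') e q
      = cubicPhaseAux Ae A2 C φ u v u' v' (e.symm q.1) (planeCovector e q.1 q.2) := rfl

lemma localExpr_cubicPhase_chartZero (C φ : ℝ) :
    localExpr (cubicPhase Ae A2 C φ u v u' v') chartZero = cubicIntegral Ae A2 C φ u v := by
  ext ⟨x, ξ⟩
  rw [localExpr_cubicPhase, chartZero_symm_apply, cubicPhaseAux_coe]
  congr 2
  ext i
  rw [covectorCoord_apply, planeCovector_apply,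
    mfderiv_chartZero_apply (chartZero_symm_apply x), inner_single]

/-- Away from the origin this is `cubicValue_inversion`, after computing how covectors transform
under inversion; at the origin it is built into the value of `cubicPhaseAux` at `∞`. -/
lemma SphereData.localExpr_cubicPhase_chartInfty (S : SphereData Ae A2 u v u' v') (C φ : ℝ) :
    localExpr (cubicPhase Ae A2 C φ u v u' v') chartInfty = cubicIntegral Ae A2 (-C) φ u' v' := by
  ext ⟨y, η⟩
  rw [localExpr_cubicPhase]
  by_cases hy : y = 0
  · subst hy
    simp only [chartInfty_symm_zero, cubicPhaseAux_infty]
    congr 2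
    ext i
    rw [covectorCoord_apply, planeCovector_apply,
      mfderiv_chartInfty_apply_infty chartInfty_symm_zero, inner_single]
  · have hs := normSq_pos hy
    have h : ∀ i, covectorCoord (planeCovector chartInfty y η) i
        = normSq y * η i - 2 * (y 0 * η 0 + y 1 * η 1) * y i := by
      intro i
      rw [covectorCoord_apply, planeCovector_apply,
        mfderiv_chartInfty_apply (inversion_ne_zero hy) (chartInfty_symm_of_ne hy), inner_plane,
        inversionDeriv_apply (inversion_ne_zero hy), inversionDeriv_apply (inversion_ne_zero hy),
        normSq_inversion]
      rcases (show i = 0 ∨ i = 1 by omega) with rfl | rfl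
      · simp [inversion_apply]
        field_simp
        ring
      · simp [inversion_apply]
        field_simp
        ring
    simp only [chartInfty_symm_of_ne hy, cubicPhaseAux_coe]
    rw [cubicIntegral, cubicIntegral]
    simp only [h, inversion_apply, normSq_inversion, S.inv_left _ hs, S.inv_right _ hs]
    have hrel := S.infty.eqn _ hs.le
    rw [S.inv_left _ hs, S.inv_right _ hs] at hrel
    exact cubicValue_inversion hs.ne' hrel

lemma SphereData.isAnalyticPolynomial_cubicPhase (S : SphereData Ae A2 u v u' v') (C φ : ℝ) :
    IsAnalyticPolynomial 3 (cubicPhase Ae A2 C φ u v u' v') := by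
  obtain ⟨a, ha, hF⟩ := S.zero.exists_cubicIntegral_coeff C φ
  obtain ⟨a', ha', hF'⟩ := S.infty.exists_cubicIntegral_coeff (-C) φ
  refine forall_mem_atlas ⟨a, fun i x _ => ha i x, fun x _ ξ => ?_⟩
    ⟨a', fun i x _ => ha' i x, fun x _ ξ => ?_⟩
  · rw [localExpr_cubicPhase_chartZero, hF]
  · rw [S.localExpr_cubicPhase_chartInfty, hF']

lemma SphereData.isGeodesicIntegral_cubicPhase (S : SphereData Ae A2 u v u' v') (hAe : 0 < Ae)
    (C φ : ℝ) : IsGeodesicIntegral (S.metric hAe) (cubicPhase Ae A2 C φ u v u' v') := by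
  refine forall_mem_atlas (fun x _ ξ => ?_) fun x _ ξ => ?_
  · rw [localExpr_cubicPhase_chartZero, S.localHamiltonian_chartZero]
    exact S.zero.poissonBracket_cubicIntegral C φ x ξ
  · rw [S.localExpr_cubicPhase_chartInfty, S.localHamiltonian_chartInfty]
    exact S.infty.poissonBracket_cubicIntegral (-C) φ x ξ

lemma SphereData.functionallyIndependent (S : SphereData Ae A2 u v u' v') (hAe : 0 < Ae)
    {C : ℝ} (hC : C ≠ 0) (φ : ℝ) : FunctionallyIndependent (S.metric hAe)
      (linearMomentum rotationField) (cubicPhase Ae A2 C φ u v u' v') := by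
  refine ⟨chartZero, chartZero_mem_atlas, 0, by rw [chartZero_target]; trivial,
    !₂[Real.sin φ, Real.cos φ], ?_⟩
  rw [localExpr_rotation_chartZero, localExpr_cubicPhase_chartZero, S.localHamiltonian_chartZero]
  exact S.zero.linearIndependent_fderiv hAe hC φ

lemma RadialData.hasDerivAt_solution_exp (R : RadialData Ae A2 u v) (x : ℝ) :
    HasDerivAt (fun s => radialSolution u v (Real.exp s))
      ((u (Real.exp x ^ 2) + Real.exp x ^ 2 * v (Real.exp x ^ 2)) / Real.exp x) x := by
  have h := (R.hasDerivAt_solution (Real.exp_pos x)).comp x (Real.hasDerivAt_exp x)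
  refine HasDerivAt.congr_deriv (f := fun s => radialSolution u v (Real.exp s)) h ?_
  have := Real.exp_pos x
  field_simp
  ring

/-- This expresses `h_xx` as `h + 4 t³ v'`, the form in which the coefficient `a₃` enters
`cubicValue_polar`. -/
lemma RadialData.hasDerivAt_deriv_solution_exp (R : RadialData Ae A2 u v) (x : ℝ) :
    HasDerivAt (deriv fun s => radialSolution u v (Real.exp s))
      (Real.exp x * v (Real.exp x ^ 2) - u (Real.exp x ^ 2) / Real.exp x
        + 4 * Real.exp x ^ 3 * deriv v (Real.exp x ^ 2)) x := by
  have hx := Real.exp_pos x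
  have h1 : (deriv fun s => radialSolution u v (Real.exp s)) = fun s =>
      (u (Real.exp s ^ 2) + Real.exp s ^ 2 * v (Real.exp s ^ 2)) / Real.exp s :=
    funext fun s => (R.hasDerivAt_solution_exp s).deriv
  rw [h1]
  have h2 := (Real.hasDerivAt_exp x).pow 2
  have h3 := HasDerivAt.comp (h := fun s => Real.exp s ^ 2) x
    (R.hasDerivAt_factor (sq_nonneg (Real.exp x))) h2
  have h4 := h3.div (Real.hasDerivAt_exp x) hx.ne'
  refine HasDerivAt.congr_deriv (f := fun s =>
      (u (Real.exp s ^ 2) + Real.exp s ^ 2 * v (Real.exp s ^ 2)) / Real.exp s) h4 ?_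
  simp
  field_simp
  ring

lemma RadialData.extendsCubicForm (R : RadialData Ae A2 u v) (u' v' : ℝ → ℝ) (C φ : ℝ) :
    ExtendsCubicForm A2 C φ (radialSolution u v) (cubicPhase Ae A2 C φ u v u' v') := by
  intro x y α
  have hx := Real.exp_pos x
  have key : ∀ β : Plane →L[ℝ] ℝ,
      cubicPhaseAux Ae A2 C φ u v u' v' (polarMap (Real.exp x, y) : S2) β
      = cubicForm A2 C φ (fun s => radialSolution u v (Real.exp s)) x y
        (β (polarDeriv (Real.exp x, y) (Real.exp x, 0)))
        (β (polarDeriv (Real.exp x, y) (0, 1))) := by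
    intro β
    set t := Real.exp x with ht
    set a := Real.cos y * covectorCoord β 0 + Real.sin y * covectorCoord β 1 with ha
    set b := -Real.sin y * covectorCoord β 0 + Real.cos y * covectorCoord β 1 with hb
    have e1 : β (polarDeriv (t, y) (t, 0)) = t * a := by
      rw [apply_eq_covectorCoord, ha]
      simp [polarDeriv]
      ring
    have e2 : β (polarDeriv (t, y) (0, 1)) = t * b := by
      rw [apply_eq_covectorCoord, hb]
      simp [polarDeriv]
      ring
    have e3 : covectorCoord β 0 = Real.cos y * a - Real.sin y * b := by
      linear_combination (-covectorCoord β 0) * Real.sin_sq_add_cos_sq y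
    have e4 : covectorCoord β 1 = Real.sin y * a + Real.cos y * b := by
      linear_combination (-covectorCoord β 1) * Real.sin_sq_add_cos_sq y
    rw [cubicPhaseAux_coe, cubicIntegral]
    simp only [e1, e2]
    rw [e3, e4, normSq_polarMap]
    refine (cubicValue_polar (V' := deriv v (t ^ 2)) hx.ne'
      (R.deriv_right _ (sq_nonneg t))).trans ?_
    simp only [cubicForm, (R.hasDerivAt_solution_exp x).deriv,
      (R.hasDerivAt_deriv_solution_exp x).deriv]
    rfl
  refine (key α).trans ?_
  congr 2
  · exact (polarVector_eq _ _).symm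
  · exact (polarVector_eq _ _).symm

end Polar

end AnalyticSphere

theorem mainTheorem2 (Ae A2 h0 : ℝ) (hAe : 0 < Ae) :
    ∃ h : ℝ → ℝ,
      IsPrincipalSolution Ae A2 h0 (Set.Ioi 0) h ∧
      (∀ (J : Set ℝ) (k : ℝ → ℝ), IsOpen J → IsPreconnected J → J ⊆ Set.Ioi 0 → (1 : ℝ) ∈ J →
        IsPrincipalSolution Ae A2 h0 J k → Set.EqOn k h J) ∧
      ∃ G : AnalyticMetric S2,
        ExtendsPolarMetric h G ∧
        (∃ V : (p : S2) → TangentSpace (𝓡 2) p,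
          ExtendsRotation V ∧
          ContMDiff (𝓡 2) (𝓡 2).tangent ω
            (fun p => (⟨p, V p⟩ : TangentBundle (𝓡 2) S2)) ∧
          IsKilling G V ∧
          IsAnalyticPolynomial 1 (linearMomentum V) ∧
          IsGeodesicIntegral G (linearMomentum V) ∧
          ∀ C φ0 : ℝ, ∃ F : PhaseFunction S2,
            ExtendsCubicForm A2 C φ0 h F ∧
            IsAnalyticPolynomial 3 F ∧
            IsGeodesicIntegral G F ∧
            (C ≠ 0 → FunctionallyIndependent G (linearMomentum V) F)) ∧
        (HasConstantCurvature G ↔ h0 = 0) := by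
  obtain ⟨u, v, u', v', S, rfl, hK⟩ := exists_sphereData A2 h0 hAe
  have hsol := S.zero.isPrincipalSolution hAe
  refine ⟨radialSolution u v, hsol, fun J k _ hJ hJ0 h1 hk => ?_, S.metric hAe,
    S.extendsPolarMetric hAe, ⟨rotationField, extendsRotation_rotationField,
      contMDiff_rotationField, S.isKilling_rotationField hAe, isAnalyticPolynomial_rotation,
      S.isGeodesicIntegral_rotation hAe, fun C φ0 => ⟨cubicPhase Ae A2 C φ0 u v u' v',
        S.zero.extendsCubicForm u' v' C φ0, S.isAnalyticPolynomial_cubicPhase C φ0,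
        S.isGeodesicIntegral_cubicPhase hAe C φ0,
        fun hC => S.functionallyIndependent hAe hC φ0⟩⟩, ?_⟩
  · exact IsPrincipalSolution.eqOn hAe hJ hJ0 h1 hk ⟨fun t ht => hsol.1 t (hJ0 ht),
      fun t ht => hsol.2.1 t (hJ0 ht), hsol.2.2⟩
  · rcases hK with ⟨h0, a, rfl, rfl, rfl, rfl⟩ | ⟨h0, hne⟩
    · exact iff_of_true (S.hasConstantCurvature hAe) h0
    · exact iff_of_false (S.not_hasConstantCurvature hAe hne) h0
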